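/- Consider a queueing system with $n\ge 1$ servers and an orbit with a single waiting place, on a filtered probability space $(\Omega,\mathcal F,(\mathcal F_t)_{t\ge0},\mathbb P)$. Customers arrive at the points of a process $A$; an arriving customer occupies a free server if there is one, goes to the orbit if all servers are busy and the orbit is empty, and is lost if all servers are busy and the orbit is occupied. At each point of a process $D$ the customer in orbit (if any) retries, and occupies a server if one is free. Services are driven by Poisson processes $\pi_1,\dots,\pi_n$ with rate $\mu>0$. Let $Q_1(t)\in\{0,\dots,n\}$ be the number of busy servers, $Q_2(t)\in\{0,1\}$ the number of customers in orbit and $Q_3(t)\in\{0,1,2,\dots\}$ the number of losses up to time $t$; these are adapted processes such that almost surely, for all $t\ge0$, $$Q_1(t)+Q_2(t)+Q_3(t)=A(t)-\int_0^t\sum_{l=1}^n\mathbf I\{Q_1(s-)\ge l\}\,d\pi_l(s),$$ $$Q_2(t)+Q_3(t)=\int_0^t\mathbf I\{Q_1(s-)=n\}\,dA(s)-\int_0^t\mathbf I\{Q_1(s-)\ne n\}\,\mathbf I\{Q_2(s-)=1\}\,dD(s),$$ $$Q_3(t)=\int_0^t\mathbf I\{Q_1(s-)=n\}\,\mathbf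 I\{Q_2(s-)=1\}\,dA(s).$$ Suppose that $A$ is a Poisson process with rate $\lambda>0$ and $D$ a Poisson process with rate $\Delta>0$, all Poisson processes being Poisson with respect to $(\mathcal F_t)$ (adapted, with increments over $(s,t]$ independent of $\mathcal F_s$), and that almost surely no two of the $n+2$ processes $A,D,\pi_1,\dots,\pi_n$ jump simultaneously. Then the limits $P_{i,j}=\lim_{t\to\infty}\mathbb P\{Q_1(t)=i,\,Q_2(t)=j\}$ exist for $0\le i\le n$, $j\in\{0,1\}$, and they satisfy $$\mu P_{1,j}=\lambda P_{0,j}+j\Delta P_{0,j}\qquad(j=0,1),$$ $$i\mu P_{i,j}-(i+1)\mu P_{i+1,j}=\lambda P_{i-1,j}-\lambda P_{i,j}+(1-j)\Delta P_{i-1,1}-j\Delta P_{i,1}\qquad(1\le i\le n-1,\ j=0,1),$$ $$n\mu P_{n,0}=\lambda P_{n-1,0}-\lambda P_{n,0}+\Delta P_{n-1,1},$$ $$n\mu P_{n,1}=\lambda P_{n-1,1}+\lambda P_{n,0}.$$ -/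

import Mathlib

open MeasureTheory ProbabilityTheory Filter Topology
open scoped NNReal

namespace RetrialQueue

/-- The value `f(t-)` just before time `t` of a path `f : [0, ∞) → ℕ`. -/
noncomputable def before (f : ℝ≥0 → ℕ) (t : ℝ≥0) : ℕ := Function.leftLim f t

/-- The instant of the `k`-th point (`k ≥ 1`) of a counting path `x`. -/
noncomputable def pointTime (x : ℝ≥0 → ℕ) (k : ℕ) : ℝ≥0 := sInf {s | k ≤ x s}

/-- The integral `∫_0^t h(s) dx(s)` along a counting path `x` with `x(0) = 0`: the sum of the
values of `h` at the points of `x` in `(0, t]`. -/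
noncomputable def countingIntegral (x : ℝ≥0 → ℕ) (h : ℝ≥0 → ℤ) (t : ℝ≥0) : ℤ :=
  ∑ k ∈ Finset.Icc 1 (x t), h (pointTime x k)

/-- Counting paths: they start at `0`, are nondecreasing, right-continuous, and have unit jumps. -/
structure IsCountingPath (x : ℝ≥0 → ℕ) : Prop where
  zero : x 0 = 0
  mono : Monotone x
  rightCont : ∀ t, ContinuousWithinAt x (Set.Ici t) t
  unitJump : ∀ t, x t ≤ before x t + 1

section

variable {Ω : Type*} [mΩ : MeasurableSpace Ω]

/-- A point process on the filtered probability space `(Ω, ℱ, P)`. -/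
structure IsPointProcess (P : Measure Ω) (ℱ : Filtration ℝ≥0 mΩ) (X : ℝ≥0 → Ω → ℕ) : Prop where
  adapted : Adapted ℱ X
  path : ∀ᵐ ω ∂P, IsCountingPath (fun t => X t ω)

/-- A Poisson process with rate `r` on the filtered probability space `(Ω, ℱ, P)`: a point process
whose increments over `(s, t]` are independent of `ℱ s` and Poisson with mean `r (t - s)`. -/
structure IsPoissonProcess (P : Measure Ω) (ℱ : Filtration ℝ≥0 mΩ) (r : ℝ≥0)
    (X : ℝ≥0 → Ω → ℕ) : Prop extends IsPointProcess P ℱ X where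
  law : ∀ s t, s ≤ t → P.map (fun ω => X t ω - X s ω) = poissonMeasure (r * (t - s))
  indep : ∀ s t, s ≤ t →
    Indep (MeasurableSpace.comap (fun ω => X t ω - X s ω) inferInstance) (ℱ s) P

/-- Almost surely, `X` and `Y` have no simultaneous jumps. -/
def DisjointJumps (P : Measure Ω) (X Y : ℝ≥0 → Ω → ℕ) : Prop :=
  ∀ᵐ ω ∂P, ∀ t, X t ω = before (fun s => X s ω) t ∨ Y t ω = before (fun s => Y s ω) t

/-- The queueing system with `n` servers, one orbit place, retrials and losses.
`A` counts the arrivals, `D` the retrial instants, and `π l` drives the departures from the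
server with index `l` (the servers being numbered `0, …, n - 1`, so that the server `l` works when
at least `l + 1` are busy).  `Q₁` is the number of busy servers, `Q₂` the number of
customers in orbit, `Q₃` the number of losses so far. -/
structure IsRetrialLossSystem (P : Measure Ω) (ℱ : Filtration ℝ≥0 mΩ) (n : ℕ) (μ : ℝ≥0)
    (A D : ℝ≥0 → Ω → ℕ) (π : Fin n → ℝ≥0 → Ω → ℕ) (Q₁ Q₂ Q₃ : ℝ≥0 → Ω → ℕ) : Prop where
  arrivals : IsPointProcess P ℱ A
  retrials : IsPointProcess P ℱ D
  services : ∀ l, IsPoissonProcess P ℱ μ (π l)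
  disjoint_arrivals_retrials : DisjointJumps P A D
  disjoint_arrivals_services : ∀ l, DisjointJumps P A (π l)
  disjoint_retrials_services : ∀ l, DisjointJumps P D (π l)
  disjoint_services : ∀ l m, l ≠ m → DisjointJumps P (π l) (π m)
  adapted₁ : Adapted ℱ Q₁
  adapted₂ : Adapted ℱ Q₂
  adapted₃ : Adapted ℱ Q₃
  /-- at most `n` servers are busy -/
  servers : ∀ᵐ ω ∂P, ∀ t, Q₁ t ω ≤ n
  /-- the orbit has one place -/
  orbit : ∀ᵐ ω ∂P, ∀ t, Q₂ t ω ≤ 1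
  /-- everybody who arrived and has not been served is in service, in orbit, or lost -/
  total_eq : ∀ᵐ ω ∂P, ∀ t,
    (Q₁ t ω : ℤ) + Q₂ t ω + Q₃ t ω = A t ω -
      ∑ l : Fin n, countingIntegral (fun s => π l s ω)
        (fun s => if (l : ℕ) + 1 ≤ before (fun u => Q₁ u ω) s then 1 else 0) t
  /-- blocked arrivals, less successful retrials -/
  orbit_eq : ∀ᵐ ω ∂P, ∀ t,
    (Q₂ t ω : ℤ) + Q₃ t ω =
      countingIntegral (fun s => A s ω)
        (fun s => if before (fun u => Q₁ u ω) s = n then 1 else 0) t -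
      countingIntegral (fun s => D s ω)
        (fun s => if before (fun u => Q₁ u ω) s ≠ n ∧ before (fun u => Q₂ u ω) s = 1
          then 1 else 0) t
  /-- losses -/
  loss_eq : ∀ᵐ ω ∂P, ∀ t,
    (Q₃ t ω : ℤ) =
      countingIntegral (fun s => A s ω)
        (fun s => if before (fun u => Q₁ u ω) s = n ∧ before (fun u => Q₂ u ω) s = 1
          then 1 else 0) t

end

end RetrialQueue

/-! The pair `(Q₁, Q₂)` is constant between points of the driving processes, and each point of `A`,
`D` or `π l` moves it by a fixed map `step` of the finite set {0, …, n} × {0, 1}. The driving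
processes are not assumed independent of one another. But the increments of each are independent of
the common past `ℱ s`, and no two processes jump together. Hence two or more points fall in an
interval of length h with probability O(h²) (`IsPoissonProcess.real_both_lt_le`). With G = ∑ r_e
(T_e - 1), the vector v(t) of state probabilities therefore satisfies v(t + h) = v(t) + h v(t) G +
O(h²), uniformly in t (`IsPoissonDriven.exists_forward_estimate`).

This estimate forces v(t + 1) = v(t) exp(G) (`eq_vecMul_exp`). The matrix exp(G) is stochastic, and
one of its columns is bounded below, because a single word of transitions sends every state to the
empty one (`applyWord_stepState_eq`). Doeblin's contraction (`sum_abs_vecMul_le`) then makes v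
Cauchy as t → ∞, and the forward estimate passes to the limit as pG = 0. Listing the preimages of
each state under `step` turns pG = 0 into the balance equations. -/

namespace RetrialQueue

/-! ### Counting paths and integrals along them -/

namespace IsCountingPath

variable {x y : ℝ≥0 → ℕ}

theorem eventually_eq_right (hx : IsCountingPath x) (t : ℝ≥0) : ∀ᶠ u in 𝓝[≥] t, x u = x t := by
  have h := hx.rightCont t
  rw [ContinuousWithinAt, nhds_discrete, tendsto_pure] at h
  exact h

theorem eventually_eq_of_eq_before (hx : IsCountingPath x) {t : ℝ≥0} (ht : x t = before x t) :
    ∀ᶠ u in 𝓝 t, x u = x t := by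
  have h := hx.mono.tendsto_leftLim t
  rw [nhds_discrete, tendsto_pure] at h
  have h' : ∀ᶠ u in 𝓝[<] t, x u = x t := by
    filter_upwards [h] with u hu
    rw [hu, ht, before]
  rw [← nhdsLT_sup_nhdsGE, eventually_sup]
  exact ⟨h', hx.eventually_eq_right t⟩

/-- Right-continuity makes the infimum defining `pointTime` a minimum. -/
theorem le_pointTime (hx : IsCountingPath x) {k : ℕ} {t : ℝ≥0} (h : k ≤ x t) :
    k ≤ x (pointTime x k) := by
  obtain ⟨u, hu, hu'⟩ := (mem_nhdsGE_iff_exists_Ico_subset' (lt_add_one (pointTime x k))).1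
    (hx.eventually_eq_right (pointTime x k))
  obtain ⟨v, hv, hvu⟩ := exists_lt_of_csInf_lt (s := {s | k ≤ x s}) ⟨t, h⟩ hu
  have hv' : pointTime x k ≤ v := csInf_le (OrderBot.bddBelow _) hv
  have := hu' ⟨hv', hvu⟩
  simp only [Set.mem_ofPred_eq] at this hv
  omega

theorem lt_of_lt_pointTime {k : ℕ} {u : ℝ≥0} (h : u < pointTime x k) : x u < k := by
  by_contra! hk
  have : pointTime x k ≤ u := csInf_le (OrderBot.bddBelow _) hk
  exact absurd this (not_le.2 h)

theorem pointTime_le {k : ℕ} {t : ℝ≥0} (h : k ≤ x t) : pointTime x k ≤ t :=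
  csInf_le (OrderBot.bddBelow _) h

theorem lt_pointTime (hx : IsCountingPath x) {k : ℕ} {s t : ℝ≥0} (hs : x s < k) (h : k ≤ x t) :
    s < pointTime x k := by
  by_contra! hk
  have := hx.mono hk
  have := hx.le_pointTime h
  omega

/-- On a fine enough partition, two counting paths without common jumps do not increase over the
same cell. -/
theorem exists_mesh (hx : IsCountingPath x) (hy : IsCountingPath y)
    (hxy : ∀ t, x t = before x t ∨ y t = before y t) (s T : ℝ≥0) :
    ∃ δ > 0, ∀ a b : ℝ≥0, s ≤ a → a ≤ T → a ≤ b → (b : ℝ) - a < δ → x a = x b ∨ y a = y b := by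
  -- Near each t, the path that does not jump at t is constant. A Lebesgue number of the resulting
  -- cover of `[s, T]` serves as δ.
  have key : ∀ t : ℝ≥0, ∃ U : Set ℝ≥0, IsOpen U ∧ t ∈ U ∧
      ∀ a ∈ U, ∀ b ∈ U, x a = x b ∨ y a = y b := by
    intro t
    rcases hxy t with h | h
    · obtain ⟨U, hU, hUo, ht⟩ := eventually_nhds_iff.1 (hx.eventually_eq_of_eq_before h)
      exact ⟨U, hUo, ht, fun a ha b hb => Or.inl ((hU a ha).trans (hU b hb).symm)⟩
    · obtain ⟨U, hU, hUo, ht⟩ := eventually_nhds_iff.1 (hy.eventually_eq_of_eq_before h)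
      exact ⟨U, hUo, ht, fun a ha b hb => Or.inr ((hU a ha).trans (hU b hb).symm)⟩
  choose U hUo hU hUxy using key
  obtain ⟨δ, hδ, h⟩ := lebesgue_number_lemma_of_metric (isCompact_Icc (a := s) (b := T)) hUo
    (fun t _ => Set.mem_iUnion.2 ⟨t, hU t⟩)
  refine ⟨δ, hδ, fun a b hsa haT hab hd => ?_⟩
  obtain ⟨i, hi⟩ := h a ⟨hsa, haT⟩
  refine hUxy i a (hi (Metric.mem_ball_self hδ)) b (hi ?_)
  rw [Metric.mem_ball, NNReal.dist_eq, abs_of_nonneg]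
  · exact hd
  · exact sub_nonneg.2 (by exact_mod_cast hab)

end IsCountingPath

theorem countingIntegral_congr_of_eq {x : ℝ≥0 → ℕ} {s t : ℝ≥0} (h : x t = x s) (f : ℝ≥0 → ℤ) :
    countingIntegral x f t = countingIntegral x f s := by
  simp only [countingIntegral, h]

theorem countingIntegral_of_eq_add_one {x : ℝ≥0 → ℕ} {s t : ℝ≥0} (h : x t = x s + 1)
    (f : ℝ≥0 → ℤ) :
    countingIntegral x f t = countingIntegral x f s + f (pointTime x (x s + 1)) := by
  simp only [countingIntegral, h]
  rw [Finset.sum_Icc_succ_top (by omega)]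

/-- The left limit of a path that is constant on `[s, t)`. -/
theorem before_eq_of_forall_eq {f : ℝ≥0 → ℕ} {s t : ℝ≥0} (hst : s < t)
    (h : ∀ u, s ≤ u → u < t → f u = f s) : before f t = f s := by
  have : (𝓝[<] t).NeBot := nhdsLT_neBot_of_exists_lt ⟨s, hst⟩
  refine leftLim_eq_of_tendsto (tendsto_nhds_of_eventually_eq ?_)
  filter_upwards [Ico_mem_nhdsLT hst] with u hu using h u hu.1 hu.2

/-! ### Poisson processes: probabilities of points in short intervals -/

section

variable {Ω : Type*} [mΩ : MeasurableSpace Ω] {P : Measure Ω} {ℱ : Filtration ℝ≥0 mΩ}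
  {r r' : ℝ≥0} {X Y : ℝ≥0 → Ω → ℕ}

theorem IsPointProcess.measurable (hX : IsPointProcess P ℱ X) (t : ℝ≥0) : Measurable (X t) :=
  (hX.adapted t).mono (ℱ.le t) le_rfl

theorem IsPointProcess.measurableSet_lt (hX : IsPointProcess P ℱ X) {s t u : ℝ≥0} (hsu : s ≤ u)
    (htu : t ≤ u) : MeasurableSet[ℱ u] {ω | X s ω < X t ω} :=
  @_root_.measurableSet_lt _ _ _ _ _ (ℱ u) _ _ _ _ _
    ((hX.adapted s).mono (ℱ.mono hsu) le_rfl) ((hX.adapted t).mono (ℱ.mono htu) le_rfl)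

namespace IsPoissonProcess

theorem real_increment_mem (hX : IsPoissonProcess P ℱ r X) {s t : ℝ≥0} (hst : s ≤ t) (B : Set ℕ) :
    P.real {ω | X t ω - X s ω ∈ B} = (poissonMeasure (r * (t - s))).real B := by
  have hm : Measurable fun ω => X t ω - X s ω := (hX.measurable t).sub (hX.measurable s)
  rw [← hX.law s t hst, map_measureReal_apply hm (MeasurableSet.of_discrete)]
  rfl

theorem real_inter_increment (hX : IsPoissonProcess P ℱ r X) {s t : ℝ≥0} (hst : s ≤ t) (B : Set ℕ)
    {F : Set Ω} (hF : MeasurableSet[ℱ s] F) :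
    P.real (F ∩ {ω | X t ω - X s ω ∈ B}) = P.real F * P.real {ω | X t ω - X s ω ∈ B} := by
  have h := (Indep_iff _ _ _).1 (hX.indep s t hst) {ω | X t ω - X s ω ∈ B} F
    ⟨B, MeasurableSet.of_discrete, rfl⟩ hF
  rw [Measure.real, Set.inter_comm, h, ENNReal.toReal_mul, mul_comm]
  rfl

theorem poissonMeasure_real_one (a : ℝ≥0) :
    (poissonMeasure a).real {1} = Real.exp (-a) * a := by
  rw [poissonMeasure_real_singleton]; simp

theorem poissonMeasure_real_pos_le (a : ℝ≥0) : (poissonMeasure a).real {0}ᶜ ≤ a := by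
  rw [probReal_compl_eq_one_sub (MeasurableSet.of_discrete), poissonMeasure_real_singleton]
  have := Real.add_one_le_exp (-(a : ℝ))
  simp
  linarith

/-- Since exp(-a) ≥ 1 - a, the mass 1 - exp(-a)(1 + a) is at most 1 - (1 - a)(1 + a) = a². -/
theorem poissonMeasure_real_two_le (a : ℝ≥0) : (poissonMeasure a).real {0, 1}ᶜ ≤ a ^ 2 := by
  rw [probReal_compl_eq_one_sub (MeasurableSet.of_discrete), Set.insert_eq,
    measureReal_union (by simp) (MeasurableSet.of_discrete), poissonMeasure_real_one,
    poissonMeasure_real_singleton]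
  have h := Real.add_one_le_exp (-(a : ℝ))
  have h0 := a.coe_nonneg
  simp only [pow_zero, mul_one, Nat.factorial_zero, Nat.cast_one, div_one]
  nlinarith

theorem real_lt_le (hX : IsPoissonProcess P ℱ r X) {s t : ℝ≥0} (hst : s ≤ t) :
    P.real {ω | X s ω < X t ω} ≤ r * (t - s) := by
  have h := hX.real_increment_mem hst {0}ᶜ
  have h2 := poissonMeasure_real_pos_le (r * (t - s))
  rw [← h] at h2
  convert h2 using 3
  · ext ω; simp [Nat.sub_eq_zero_iff_le]
  · push_cast [NNReal.coe_sub hst]; rfl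

theorem real_two_le (hX : IsPoissonProcess P ℱ r X) {s t : ℝ≥0} (hst : s ≤ t) :
    P.real {ω | 2 ≤ X t ω - X s ω} ≤ (r * (t - s)) ^ 2 := by
  have h := hX.real_increment_mem hst {0, 1}ᶜ
  have h2 := poissonMeasure_real_two_le (r * (t - s))
  rw [← h] at h2
  convert h2 using 3
  · ext ω; simp; omega
  · push_cast [NNReal.coe_sub hst]; rfl

theorem abs_real_one_sub_le (hX : IsPoissonProcess P ℱ r X) {s t : ℝ≥0} (hst : s ≤ t) :
    |P.real {ω | X t ω - X s ω ∈ ({1} : Set ℕ)} - r * (t - s)| ≤ (r * (t - s)) ^ 2 := by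
  rw [hX.real_increment_mem hst, poissonMeasure_real_one]
  push_cast [NNReal.coe_sub hst]
  set a : ℝ := r * (t - s) with ha
  have ha0 : 0 ≤ a := mul_nonneg r.coe_nonneg (sub_nonneg.2 (by exact_mod_cast hst))
  have h := Real.add_one_le_exp (-a)
  have h1 : Real.exp (-a) ≤ 1 := Real.exp_le_one_iff.2 (by linarith)
  rw [abs_le]
  constructor <;> nlinarith

/-- The earlier increase of `Y` is an event of `ℱ t`, of which the later increment of `X` is
independent. This replaces independence of `X` and `Y`, which is not available. -/
theorem real_lt_and_lt_le (hX : IsPoissonProcess P ℱ r X) (hY : IsPoissonProcess P ℱ r' Y)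
    {s t u : ℝ≥0} (hst : s ≤ t) (htu : t ≤ u) :
    P.real {ω | Y s ω < Y t ω ∧ X t ω < X u ω} ≤ r' * (t - s) * (r * (u - t)) := by
  have h := hX.real_inter_increment htu {0}ᶜ (hY.measurableSet_lt hst le_rfl)
  have e : {ω | X u ω - X t ω ∈ ({0}ᶜ : Set ℕ)} = {ω | X t ω < X u ω} := by
    ext ω; simp [Nat.sub_eq_zero_iff_le]
  rw [e] at h
  have h' : {ω | Y s ω < Y t ω ∧ X t ω < X u ω} = {ω | Y s ω < Y t ω} ∩ {ω | X t ω < X u ω} := rfl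
  rw [h', h]
  have hd : (0 : ℝ) ≤ t - s := sub_nonneg.2 (by exact_mod_cast hst)
  gcongr
  · exact hY.real_lt_le hst
  · exact hX.real_lt_le htu

end IsPoissonProcess

/-- A point of the equidistant partition of `[s, s + h]` into `m` cells. -/
noncomputable def gridPoint (s h : ℝ≥0) (m k : ℕ) : ℝ≥0 := s + k * (h / m)

theorem gridPoint_mono (s h : ℝ≥0) (m : ℕ) : Monotone (gridPoint s h m) := by
  intro a b hab
  unfold gridPoint
  gcongr

theorem gridPoint_zero (s h : ℝ≥0) (m : ℕ) : gridPoint s h m 0 = s := by simp [gridPoint]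

theorem gridPoint_self (s h : ℝ≥0) {m : ℕ} (hm : m ≠ 0) : gridPoint s h m m = s + h := by
  have : (m : ℝ≥0) ≠ 0 := by exact_mod_cast hm
  rw [gridPoint, mul_div_cancel₀ _ this]

theorem le_gridPoint (s h : ℝ≥0) (m k : ℕ) : s ≤ gridPoint s h m k := le_self_add

theorem gridPoint_succ_sub (s h : ℝ≥0) (m k : ℕ) :
    (gridPoint s h m (k + 1) : ℝ) - gridPoint s h m k = h / m := by
  simp only [gridPoint]; push_cast; ring

theorem exists_lt_succ_of_lt {x : ℕ → ℕ} {m : ℕ} (h : x 0 < x m) : ∃ k < m, x k < x (k + 1) := by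
  by_contra! H
  have : ∀ k ≤ m, x k ≤ x 0 := by
    intro k
    induction k with
    | zero => simp
    | succ k ih => exact fun hk => (H k hk).trans (ih (by omega))
  have := this m le_rfl
  omega

variable [IsProbabilityMeasure P]

/-- The probability that two point processes without common jumps both increase over the same cell
of the equidistant partition tends to zero. -/
theorem DisjointJumps.tendsto_common_cell (hX : IsPointProcess P ℱ X) (hY : IsPointProcess P ℱ Y)
    (hXY : DisjointJumps P X Y) (s h : ℝ≥0) :
    Tendsto (fun m : ℕ => P.real (⋃ k ∈ Finset.range m,
      {ω | X (gridPoint s h m k) ω < X (gridPoint s h m (k + 1)) ω ∧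
        Y (gridPoint s h m k) ω < Y (gridPoint s h m (k + 1)) ω})) atTop (𝓝 0) := by
  have key := tendsto_measure_of_ae_tendsto_indicator_of_isFiniteMeasure (μ := P) atTop
    (A := ∅) MeasurableSet.empty (As := fun m : ℕ => ⋃ k ∈ Finset.range m,
      {ω | X (gridPoint s h m k) ω < X (gridPoint s h m (k + 1)) ω ∧
        Y (gridPoint s h m k) ω < Y (gridPoint s h m (k + 1)) ω})
    (fun m => Finset.measurableSet_biUnion _ fun k _ =>
      (measurableSet_lt (hX.measurable _) (hX.measurable _)).inter
        (measurableSet_lt (hY.measurable _) (hY.measurable _))) ?_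
  · have := (ENNReal.tendsto_toReal (measure_ne_top P ∅)).comp key
    simpa using! this
  -- For almost every path, cells shorter than the δ of `exists_mesh` contain no common increase, so
  -- the event fails from some m on.
  · filter_upwards [hX.path, hY.path, hXY] with ω hx hy hxy
    obtain ⟨δ, hδ, H⟩ := hx.exists_mesh hy hxy s (s + h)
    have hlim : Tendsto (fun m : ℕ => (h : ℝ) / m) atTop (𝓝 0) :=
      tendsto_const_div_atTop_nhds_zero_nat _
    filter_upwards [hlim.eventually_lt_const hδ] with m hm
    simp only [Set.mem_empty_iff_false, iff_false, Set.mem_iUnion, not_exists]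
    rintro k hk ⟨h1, h2⟩
    have hk : k < m := Finset.mem_range.1 hk
    rcases H (gridPoint s h m k) (gridPoint s h m (k + 1)) (le_gridPoint ..)
      (by rw [← gridPoint_self s h (by omega : m ≠ 0)]; exact gridPoint_mono s h m hk.le)
      (gridPoint_mono s h m k.le_succ) (by rw [gridPoint_succ_sub]; exact hm) with h3 | h3
    · exact h1.ne h3
    · exact h2.ne h3

/-- Two Poisson processes without common jumps both increase over an interval of length `h` with
probability `O(h²)`. -/
theorem IsPoissonProcess.real_both_lt_le (hX : IsPoissonProcess P ℱ r X)
    (hY : IsPoissonProcess P ℱ r' Y) (hXY : DisjointJumps P X Y) (s h : ℝ≥0) :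
    P.real {ω | X s ω < X (s + h) ω ∧ Y s ω < Y (s + h) ω} ≤ 2 * r * r' * h ^ 2 := by
  have hlim := (hXY.tendsto_common_cell hX.toIsPointProcess hY.toIsPointProcess s h).add_const
    (2 * r * r' * h ^ 2 : ℝ)
  rw [zero_add] at hlim
  -- For every m the bound holds up to the probability of a common cell, which vanishes as m → ∞.
  refine ge_of_tendsto hlim ?_
  filter_upwards [eventually_ge_atTop 1] with m hm
  set g := gridPoint s h m with hg
  have hm0 : m ≠ 0 := by omega
  have hmr : (m : ℝ) ≠ 0 := by exact_mod_cast hm0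
  set B := ⋃ k ∈ Finset.range m, {ω | X (g k) ω < X (g (k + 1)) ω ∧ Y (g k) ω < Y (g (k + 1)) ω}
  set B₁ := ⋃ k ∈ Finset.range m, {ω | Y s ω < Y (g k) ω ∧ X (g k) ω < X (g (k + 1)) ω}
  set B₂ := ⋃ k ∈ Finset.range m, {ω | X s ω < X (g k) ω ∧ Y (g k) ω < Y (g (k + 1)) ω}
  -- The m cells contribute at most q' h · q h / m each, so the total does not depend on m.
  have bound : ∀ {q q' : ℝ≥0} {U V : ℝ≥0 → Ω → ℕ}, IsPoissonProcess P ℱ q U →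
      IsPoissonProcess P ℱ q' V → P.real (⋃ k ∈ Finset.range m,
        {ω | V s ω < V (g k) ω ∧ U (g k) ω < U (g (k + 1)) ω}) ≤ q * q' * h ^ 2 := by
    intro q q' U V hU hV
    calc _ ≤ ∑ k ∈ Finset.range m, P.real {ω | V s ω < V (g k) ω ∧ U (g k) ω < U (g (k + 1)) ω} :=
          measureReal_biUnion_finset_le _ _
      _ ≤ ∑ k ∈ Finset.range m, (q' * h * (q * (h / m)) : ℝ) := by
          refine Finset.sum_le_sum fun k hk => ?_
          refine (hU.real_lt_and_lt_le hV (le_gridPoint s h m k)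
            (gridPoint_mono s h m k.le_succ)).trans ?_
          rw [gridPoint_succ_sub]
          gcongr
          have : gridPoint s h m k ≤ s + h := by
            rw [← gridPoint_self s h hm0]
            exact gridPoint_mono s h m (Finset.mem_range.1 hk).le
          have : (gridPoint s h m k : ℝ) ≤ s + h := by exact_mod_cast this
          linarith
      _ = q * q' * h ^ 2 := by
          rw [Finset.sum_const, Finset.card_range, nsmul_eq_mul]
          field_simp
  -- A cell where `X` increases and a cell where `Y` increases either coincide or are ordered; the
  -- three cases give `B`, `B₁` and `B₂`.
  have hsub : P.real {ω | X s ω < X (s + h) ω ∧ Y s ω < Y (s + h) ω} ≤ P.real (B ∪ (B₁ ∪ B₂)) := by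
    refine ENNReal.toReal_mono (measure_ne_top _ _) (measure_mono_ae ?_)
    filter_upwards [hX.path, hY.path] with ω hx hy hω
    obtain ⟨h1, h2⟩ : X s ω < X (s + h) ω ∧ Y s ω < Y (s + h) ω := hω
    have e0 : g 0 = s := gridPoint_zero s h m
    have em : g m = s + h := gridPoint_self s h hm0
    have hgm : Monotone g := gridPoint_mono s h m
    obtain ⟨k, hk, hk'⟩ := exists_lt_succ_of_lt (x := fun k => X (g k) ω) (m := m)
      (by simpa [e0, em] using h1)
    obtain ⟨j, hj, hj'⟩ := exists_lt_succ_of_lt (x := fun k => Y (g k) ω) (m := m)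
      (by simpa [e0, em] using h2)
    have step : ∀ {z : ℝ≥0 → ℕ}, Monotone z → ∀ {a b : ℕ}, a < b → z (g a) < z (g (a + 1)) →
        z s < z (g b) := by
      intro z hz a b hab hz'
      rw [← e0]
      exact ((hz (hgm (Nat.zero_le a))).trans_lt hz').trans_le (hz (hgm hab))
    rcases lt_trichotomy j k with hjk | hjk | hjk
    · exact Or.inr (Or.inl (Set.mem_biUnion (Finset.mem_coe.2 (Finset.mem_range.2 hk))
        ⟨step hy.mono hjk hj', hk'⟩))
    · subst hjk
      exact Or.inl (Set.mem_biUnion (Finset.mem_coe.2 (Finset.mem_range.2 hk)) ⟨hk', hj'⟩)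
    · exact Or.inr (Or.inr (Set.mem_biUnion (Finset.mem_coe.2 (Finset.mem_range.2 hj))
        ⟨step hx.mono hjk hk', hj'⟩))
  have h12 := measureReal_union_le (μ := P) B₁ B₂
  have h0 := measureReal_union_le (μ := P) B (B₁ ∪ B₂)
  have hB₁ : P.real B₁ ≤ r * r' * h ^ 2 := bound hX hY
  have hB₂ : P.real B₂ ≤ r' * r * h ^ 2 := bound hY hX
  nlinarith

end

/-! ### Processes driven by Poisson points: the forward equation -/

section

variable {Ω : Type*} [mΩ : MeasurableSpace Ω] {E S : Type*}

/-- A process `Q` driven by Poisson processes `N e` of rates `r e` without common jumps: a jump of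
`N e` moves `Q` from `x` to `T e x`. -/
structure IsPoissonDriven (P : Measure Ω) (ℱ : Filtration ℝ≥0 mΩ) (r : E → ℝ≥0)
    (N : E → ℝ≥0 → Ω → ℕ) (T : E → S → S) (Q : ℝ≥0 → Ω → S) : Prop where
  poisson : ∀ e, IsPoissonProcess P ℱ (r e) (N e)
  disjoint : ∀ e e', e ≠ e' → DisjointJumps P (N e) (N e')
  adapted : ∀ t (B : Set S), MeasurableSet[ℱ t] {ω | Q t ω ∈ B}
  stay : ∀ᵐ ω ∂P, ∀ s t, s ≤ t → (∀ e, N e t ω = N e s ω) → Q t ω = Q s ω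
  jump : ∀ᵐ ω ∂P, ∀ s t, s ≤ t → ∀ e, N e t ω = N e s ω + 1 →
    (∀ e', e' ≠ e → N e' t ω = N e' s ω) → Q t ω = T e (Q s ω)

namespace IsPoissonDriven

variable [Fintype E] {P : Measure Ω} [IsProbabilityMeasure P]
  {ℱ : Filtration ℝ≥0 mΩ} {r : E → ℝ≥0} {N : E → ℝ≥0 → Ω → ℕ} {T : E → S → S} {Q : ℝ≥0 → Ω → S}

/-- The event that at least two jumps occur in `(s, t]`. -/
def multipleJumps (N : E → ℝ≥0 → Ω → ℕ) (s t : ℝ≥0) : Set Ω :=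
  (⋃ e, {ω | 2 ≤ N e t ω - N e s ω}) ∪
    ⋃ e, ⋃ e', {ω | e ≠ e' ∧ N e s ω < N e t ω ∧ N e' s ω < N e' t ω}

omit [IsProbabilityMeasure P] in
theorem measurableSet_multipleJumps (hQ : IsPoissonDriven P ℱ r N T Q) (s t : ℝ≥0) :
    MeasurableSet (multipleJumps N s t) := by
  have hm : ∀ e u, Measurable (N e u) := fun e u => (hQ.poisson e).measurable u
  refine .union (.iUnion fun e => ?_) (.iUnion fun e => .iUnion fun e' => ?_)
  · exact measurableSet_le measurable_const ((hm e t).sub (hm e s))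
  · exact (MeasurableSet.const _).inter
      ((measurableSet_lt (hm e s) (hm e t)).inter (measurableSet_lt (hm e' s) (hm e' t)))

theorem real_multipleJumps_le (hQ : IsPoissonDriven P ℱ r N T Q) (s h : ℝ≥0) :
    P.real (multipleJumps N s (s + h)) ≤ (∑ e, (r e : ℝ) ^ 2 + ∑ e, ∑ e', (2 * r e * r e' : ℝ)) * h ^ 2 := by
  refine (measureReal_union_le _ _).trans ?_
  rw [add_mul, Finset.sum_mul, Finset.sum_mul]
  refine add_le_add ((measureReal_iUnion_fintype_le _).trans (Finset.sum_le_sum fun e _ => ?_))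
    ((measureReal_iUnion_fintype_le _).trans (Finset.sum_le_sum fun e _ => ?_))
  · refine ((hQ.poisson e).real_two_le le_self_add).trans (le_of_eq ?_)
    push_cast; ring
  · rw [Finset.sum_mul]
    refine (measureReal_iUnion_fintype_le _).trans (Finset.sum_le_sum fun e' _ => ?_)
    -- The diagonal events are empty; the double sum keeps them only to simplify the constant.
    by_cases he : e = e'
    · simp only [he, ne_eq, not_true_eq_false, false_and]
      rw [show {_ω : Ω | False} = ∅ from rfl, measureReal_empty]
      positivity
    · simp only [ne_eq, he, not_false_eq_true, true_and]
      exact (hQ.poisson e).real_both_lt_le (hQ.poisson e') (hQ.disjoint e e' he) s h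

/-- The error committed when at most one jump in `(s, t]` is taken into account. -/
noncomputable def jumpError (N : E → ℝ≥0 → Ω → ℕ) (T : E → S → S) (Q : ℝ≥0 → Ω → S) (y : S)
    (s t : ℝ≥0) (ω : Ω) : ℝ :=
  {ω | Q t ω ∈ ({y} : Set S)}.indicator 1 ω - {ω | Q s ω ∈ ({y} : Set S)}.indicator 1 ω -
    ∑ e, (({ω | Q s ω ∈ T e ⁻¹' {y}} ∩ {ω | N e t ω - N e s ω ∈ ({1} : Set ℕ)}).indicator 1 ω -
      ({ω | Q s ω ∈ ({y} : Set S)} ∩ {ω | N e t ω - N e s ω ∈ ({1} : Set ℕ)}).indicator 1 ω)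

omit mΩ in
theorem abs_indicator_sub_indicator_le (A B : Set Ω) (ω : Ω) :
    |A.indicator (1 : Ω → ℝ) ω - B.indicator 1 ω| ≤ 1 := by
  by_cases hA : ω ∈ A <;> by_cases hB : ω ∈ B <;> simp [hA, hB]

omit mΩ in
theorem indicator_congr {A B : Set Ω} {ω : Ω} (h : ω ∈ A ↔ ω ∈ B) :
    A.indicator (1 : Ω → ℝ) ω = B.indicator 1 ω := by
  by_cases hA : ω ∈ A <;> simp [hA, ← h]

omit mΩ in
theorem abs_jumpError_le (y : S) (s t : ℝ≥0) (ω : Ω) :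
    |jumpError N T Q y s t ω| ≤ 1 + Fintype.card E := by
  refine (abs_sub _ _).trans (add_le_add (abs_indicator_sub_indicator_le _ _ ω) ?_)
  refine (Finset.abs_sum_le_sum_abs _ _).trans ?_
  refine (Finset.sum_le_sum fun e _ => abs_indicator_sub_indicator_le _ _ ω).trans ?_
  simp

-- Outside `multipleJumps` either nothing jumps, and all terms cancel by `stay`, or exactly one
-- driver jumps once, and only its summand survives and matches the change of the indicator by
-- `jump`.
omit [IsProbabilityMeasure P] in
theorem jumpError_eq_zero (hQ : IsPoissonDriven P ℱ r N T Q) (y : S) {s t : ℝ≥0} (hst : s ≤ t) :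
    ∀ᵐ ω ∂P, ω ∉ multipleJumps N s t → jumpError N T Q y s t ω = 0 := by
  have hpath : ∀ᵐ ω ∂P, ∀ e, IsCountingPath (fun t => N e t ω) :=
    ae_all_iff.2 fun e => (hQ.poisson e).path
  filter_upwards [hpath, hQ.stay, hQ.jump] with ω hx hstay hjump hω
  have hle : ∀ e, N e s ω ≤ N e t ω := fun e => (hx e).mono hst
  simp only [multipleJumps, Set.mem_union, Set.mem_iUnion, not_or, not_exists] at hω
  obtain ⟨hω1, hω2⟩ := hω
  have h1 : ∀ e, N e t ω - N e s ω ≤ 1 := fun e => by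
    have : ¬ 2 ≤ N e t ω - N e s ω := hω1 e
    omega
  have h2 : ∀ e e', e ≠ e' → N e s ω < N e t ω → N e' t ω = N e' s ω := fun e e' hne hlt => by
    have : ¬ (e ≠ e' ∧ N e s ω < N e t ω ∧ N e' s ω < N e' t ω) := hω2 e e'
    have := hle e'
    by_contra hne'
    exact this.lt_of_ne (Ne.symm hne') |> fun h => by tauto
  by_cases hall : ∀ e, N e t ω = N e s ω
  · have hst' := hstay s t hst hall
    simp only [jumpError]
    rw [Finset.sum_eq_zero]
    · rw [indicator_congr (A := {ω | Q t ω ∈ ({y} : Set S)})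
        (B := {ω | Q s ω ∈ ({y} : Set S)}) (ω := ω) (by rw [Set.mem_ofPred_eq, hst']; rfl),
        sub_self, sub_zero]
    · intro e _
      simp [Set.indicator, hall e]
  · push Not at hall
    obtain ⟨e, he⟩ := hall
    have he1 : N e t ω = N e s ω + 1 := by have := h1 e; have := hle e; omega
    have hoth : ∀ e', e' ≠ e → N e' t ω = N e' s ω := fun e' hne =>
      h2 e e' hne.symm (by omega)
    have hj := hjump s t hst e he1 hoth
    simp only [jumpError]
    rw [Finset.sum_eq_single e]
    · rw [indicator_congr (A := {ω | Q t ω ∈ ({y} : Set S)})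
        (B := {ω | Q s ω ∈ T e ⁻¹' {y}} ∩ {ω | N e t ω - N e s ω ∈ ({1} : Set ℕ)}) (ω := ω)
        (by simp [Set.mem_ofPred_eq, hj, he1]),
        indicator_congr (A := {ω | Q s ω ∈ ({y} : Set S)})
        (B := {ω | Q s ω ∈ ({y} : Set S)} ∩ {ω | N e t ω - N e s ω ∈ ({1} : Set ℕ)}) (ω := ω)
        (by simp [he1]), sub_self]
    · intro e' _ hne
      simp [Set.indicator, hoth e' hne]
    · simp

/-- The state at time s is `ℱ s`-measurable, so each expectation factors into the probability of one
jump and a probability at time s. -/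
theorem integral_jumpError (hQ : IsPoissonDriven P ℱ r N T Q) (y : S) {s t : ℝ≥0} (hst : s ≤ t) :
    ∫ ω, jumpError N T Q y s t ω ∂P =
      P.real {ω | Q t ω ∈ ({y} : Set S)} - P.real {ω | Q s ω ∈ ({y} : Set S)} -
      ∑ e, P.real {ω | N e t ω - N e s ω ∈ ({1} : Set ℕ)} *
        (P.real {ω | Q s ω ∈ T e ⁻¹' {y}} - P.real {ω | Q s ω ∈ ({y} : Set S)}) := by
  have hB : ∀ u B, MeasurableSet {ω | Q u ω ∈ B} := fun u B => ℱ.le u _ (hQ.adapted u B)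
  have hJ : ∀ e, MeasurableSet {ω | N e t ω - N e s ω ∈ ({1} : Set ℕ)} := fun e =>
    (((hQ.poisson e).measurable t).sub ((hQ.poisson e).measurable s)) MeasurableSet.of_discrete
  have hint : ∀ {A : Set Ω}, MeasurableSet A → Integrable (A.indicator (1 : Ω → ℝ)) P :=
    fun hA => (integrable_const (1 : ℝ)).indicator hA
  have hI : ∀ {A B : Set Ω}, MeasurableSet A → MeasurableSet B →
      Integrable (fun ω => A.indicator (1 : Ω → ℝ) ω - B.indicator 1 ω) P ∧
        ∫ ω, (A.indicator (1 : Ω → ℝ) ω - B.indicator 1 ω) ∂P = P.real A - P.real B :=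
    fun hA hB => ⟨(hint hA).sub (hint hB), by
      rw [integral_sub (hint hA) (hint hB), integral_indicator_one hA, integral_indicator_one hB]⟩
  have hM : ∀ B e, MeasurableSet ({ω | Q s ω ∈ B} ∩ {ω | N e t ω - N e s ω ∈ ({1} : Set ℕ)}) :=
    fun B e => (hB s B).inter (hJ e)
  simp only [jumpError]
  rw [integral_sub (hI (hB t _) (hB s _)).1
      (integrable_finsetSum _ fun e _ => (hI (hM _ e) (hM _ e)).1), (hI (hB t _) (hB s _)).2,
    integral_finsetSum _ fun e _ => (hI (hM _ e) (hM _ e)).1]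
  congr 1
  refine Finset.sum_congr rfl fun e _ => ?_
  rw [(hI (hM _ e) (hM _ e)).2,
    (hQ.poisson e).real_inter_increment hst _ (hQ.adapted s _),
    (hQ.poisson e).real_inter_increment hst _ (hQ.adapted s _)]
  ring

/-- The forward equation of a Poisson-driven process, in integrated form. -/
theorem exists_forward_estimate (hQ : IsPoissonDriven P ℱ r N T Q) :
    ∃ C : ℝ, ∀ (y : S) (s h : ℝ≥0),
      |P.real {ω | Q (s + h) ω ∈ ({y} : Set S)} - P.real {ω | Q s ω ∈ ({y} : Set S)} -
        h * ∑ e, r e * (P.real {ω | Q s ω ∈ T e ⁻¹' {y}} - P.real {ω | Q s ω ∈ ({y} : Set S)})|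
        ≤ C * h ^ 2 := by
  -- There are two sources of error: multiple jumps, where `jumpError` is at most `1 + card E`, and
  -- the replacement of the probability of exactly one point by r_e h, which costs (r_e h)² for each
  -- driver.
  refine ⟨(1 + Fintype.card E) * (∑ e, (r e : ℝ) ^ 2 + ∑ e, ∑ e', (2 * r e * r e' : ℝ)) +
    ∑ e, (r e : ℝ) ^ 2, fun y s h => ?_⟩
  have hst : s ≤ s + h := le_self_add
  have hI := hQ.integral_jumpError y hst
  have hbound : |∫ ω, jumpError N T Q y s (s + h) ω ∂P| ≤
      (1 + Fintype.card E) * ((∑ e, (r e : ℝ) ^ 2 + ∑ e, ∑ e', (2 * r e * r e' : ℝ)) * h ^ 2) := by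
    have hm := hQ.measurableSet_multipleJumps s (s + h)
    calc |∫ ω, jumpError N T Q y s (s + h) ω ∂P|
        ≤ ∫ ω, (multipleJumps N s (s + h)).indicator (fun _ => (1 + Fintype.card E : ℝ)) ω ∂P := by
          have hint : Integrable ((multipleJumps N s (s + h)).indicator
              fun _ => (1 + Fintype.card E : ℝ)) P := (integrable_const _).indicator hm
          rw [← Real.norm_eq_abs]
          refine norm_integral_le_of_norm_le hint ?_
          filter_upwards [hQ.jumpError_eq_zero y hst] with ω hω
          by_cases hb : ω ∈ multipleJumps N s (s + h)
          · rw [Set.indicator_of_mem hb]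
            exact abs_jumpError_le y s (s + h) ω
          · rw [Set.indicator_of_notMem hb, hω hb, norm_zero]
      _ = (1 + Fintype.card E) * P.real (multipleJumps N s (s + h)) := by
          rw [integral_indicator_const _ hm, smul_eq_mul, mul_comm]
      _ ≤ _ := by
          gcongr
          exact hQ.real_multipleJumps_le s h
  have hlin : |∑ e, (P.real {ω | N e (s + h) ω - N e s ω ∈ ({1} : Set ℕ)} - r e * h) *
      (P.real {ω | Q s ω ∈ T e ⁻¹' {y}} - P.real {ω | Q s ω ∈ ({y} : Set S)})| ≤
      (∑ e, (r e : ℝ) ^ 2) * h ^ 2 := by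
    rw [Finset.sum_mul]
    refine (Finset.abs_sum_le_sum_abs _ _).trans (Finset.sum_le_sum fun e _ => ?_)
    have h1 := (hQ.poisson e).abs_real_one_sub_le hst
    have h2 : ((s + h : ℝ≥0) : ℝ) - s = h := by push_cast; ring
    rw [h2, mul_pow] at h1
    rw [abs_mul, ← mul_one ((r e : ℝ) ^ 2 * _)]
    refine mul_le_mul h1 ?_ (abs_nonneg _) (by positivity)
    rw [abs_le]
    constructor <;>
    linarith [measureReal_nonneg (μ := P) (s := {ω | Q s ω ∈ T e ⁻¹' {y}}),
      measureReal_nonneg (μ := P) (s := {ω | Q s ω ∈ ({y} : Set S)}),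
      measureReal_le_one (μ := P) (s := {ω | Q s ω ∈ T e ⁻¹' {y}}),
      measureReal_le_one (μ := P) (s := {ω | Q s ω ∈ ({y} : Set S)})]
  have hsplit : P.real {ω | Q (s + h) ω ∈ ({y} : Set S)} - P.real {ω | Q s ω ∈ ({y} : Set S)} -
      h * ∑ e, r e * (P.real {ω | Q s ω ∈ T e ⁻¹' {y}} - P.real {ω | Q s ω ∈ ({y} : Set S)}) =
      ∫ ω, jumpError N T Q y s (s + h) ω ∂P +
      ∑ e, (P.real {ω | N e (s + h) ω - N e s ω ∈ ({1} : Set ℕ)} - r e * h) *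
      (P.real {ω | Q s ω ∈ T e ⁻¹' {y}} - P.real {ω | Q s ω ∈ ({y} : Set S)}) := by
    rw [hI, Finset.mul_sum]
    simp only [sub_mul, Finset.sum_sub_distrib]
    rw [sub_add_sub_cancel]
    congr 1
    exact Finset.sum_congr rfl fun e _ => by ring
  rw [hsplit]
  refine (abs_add_le _ _).trans ((add_le_add hbound hlin).trans (le_of_eq (by ring)))

end IsPoissonDriven

end

/-! ### Finite-state generators and convergence to equilibrium -/

section

variable {S : Type*} [Fintype S] [DecidableEq S]

open scoped Matrix Matrix.Norms.Operator Nat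

/-- The matrix of the map `f`, acting on row vectors. -/
def mapMatrix (f : S → S) : Matrix S S ℝ := fun x y => if f x = y then 1 else 0

theorem mapMatrix_mulVec_one (f : S → S) : mapMatrix f *ᵥ 1 = 1 := by
  ext x
  simp [mapMatrix, Matrix.mulVec, dotProduct]

omit [Fintype S] in
theorem mapMatrix_nonneg (f : S → S) (x y : S) : 0 ≤ mapMatrix f x y := by
  unfold mapMatrix; split_ifs <;> simp

theorem vecMul_mapMatrix (v : S → ℝ) (f : S → S) (y : S) :
    (v ᵥ* mapMatrix f) y = ∑ x with f x = y, v x := by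
  simp [mapMatrix, Matrix.vecMul, dotProduct, Finset.sum_filter]

variable {E : Type*} [Fintype E]

/-- The jump rates of the chain driven by the maps `T e` with rates `r e`. -/
def jumpMatrix (r : E → ℝ≥0) (T : E → S → S) : Matrix S S ℝ := ∑ e, (r e : ℝ) • mapMatrix (T e)

/-- The generator of the chain driven by the maps `T e` with rates `r e`. -/
def generator (r : E → ℝ≥0) (T : E → S → S) : Matrix S S ℝ :=
  jumpMatrix r T - (∑ e, (r e : ℝ)) • 1

omit [Fintype S] in
theorem jumpMatrix_nonneg (r : E → ℝ≥0) (T : E → S → S) (x y : S) : 0 ≤ jumpMatrix r T x y := by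
  simp only [jumpMatrix, Matrix.sum_apply, Matrix.smul_apply, smul_eq_mul]
  exact Finset.sum_nonneg fun e _ => mul_nonneg (r e).2 (mapMatrix_nonneg _ _ _)

theorem generator_mulVec_one (r : E → ℝ≥0) (T : E → S → S) : generator r T *ᵥ 1 = 0 := by
  simp [generator, jumpMatrix, Matrix.sub_mulVec, Matrix.sum_mulVec, Matrix.smul_mulVec,
    mapMatrix_mulVec_one, Finset.sum_smul]

omit [DecidableEq S] in
theorem mul_nonneg_apply {A B : Matrix S S ℝ} (hA : ∀ x y, 0 ≤ A x y) (hB : ∀ x y, 0 ≤ B x y)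
    (x y : S) : 0 ≤ (A * B) x y := by
  rw [Matrix.mul_apply]
  exact Finset.sum_nonneg fun z _ => mul_nonneg (hA x z) (hB z y)

theorem pow_nonneg_apply {A : Matrix S S ℝ} (hA : ∀ x y, 0 ≤ A x y) (k : ℕ) (x y : S) :
    0 ≤ (A ^ k) x y := by
  induction k generalizing x y with
  | zero => rw [pow_zero, Matrix.one_apply]; split_ifs <;> simp
  | succ k ih => rw [pow_succ]; exact mul_nonneg_apply ih hA x y

theorem hasSum_exp_apply (A : Matrix S S ℝ) (x y : S) :
    HasSum (fun k : ℕ => (k ! : ℝ)⁻¹ * (A ^ k) x y) (NormedSpace.exp A x y) := by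
  have h := NormedSpace.exp_series_hasSum_exp' (𝕂 := ℝ) A
  exact Pi.hasSum.1 (Pi.hasSum.1 h x) y

theorem pow_le_exp_apply {A : Matrix S S ℝ} (hA : ∀ x y, 0 ≤ A x y) (k : ℕ) (x y : S) :
    (k ! : ℝ)⁻¹ * (A ^ k) x y ≤ NormedSpace.exp A x y :=
  le_hasSum (hasSum_exp_apply A x y) k fun j _ =>
    mul_nonneg (by positivity) (pow_nonneg_apply hA j x y)

/-- Uniformization: the generator differs from a nonnegative matrix by a scalar matrix, which
commutes with it. Positivity of the exponential can thus be read off the power series of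
`jumpMatrix`. -/
theorem exp_generator (r : E → ℝ≥0) (T : E → S → S) :
    NormedSpace.exp (generator r T) =
      Real.exp (-∑ e, (r e : ℝ)) • NormedSpace.exp (jumpMatrix r T) := by
  have h : generator r T = (-∑ e, (r e : ℝ)) • (1 : Matrix S S ℝ) + jumpMatrix r T := by
    rw [generator, neg_smul]; abel
  rw [h, Matrix.exp_add_of_commute _ _ ((Commute.one_left _).smul_left _)]
  have : NormedSpace.exp ((-∑ e, (r e : ℝ)) • (1 : Matrix S S ℝ)) =
      Real.exp (-∑ e, (r e : ℝ)) • (1 : Matrix S S ℝ) := by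
    rw [← Algebra.algebraMap_eq_smul_one, ← Algebra.algebraMap_eq_smul_one,
      Real.exp_eq_exp_ℝ, NormedSpace.algebraMap_exp_comm]
    rfl
  rw [this, smul_mul_assoc, one_mul]

theorem exp_generator_nonneg (r : E → ℝ≥0) (T : E → S → S) (x y : S) :
    0 ≤ NormedSpace.exp (generator r T) x y := by
  rw [exp_generator, Matrix.smul_apply, smul_eq_mul]
  exact mul_nonneg (Real.exp_pos _).le ((mul_nonneg (by positivity)
    (pow_nonneg_apply (jumpMatrix_nonneg r T) 0 x y)).trans
    (pow_le_exp_apply (jumpMatrix_nonneg r T) 0 x y))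

/-- The generator annihilates the constant vector, so only the zeroth term of the series contributes
to a row sum. -/
theorem exp_generator_sum (r : E → ℝ≥0) (T : E → S → S) (x : S) :
    ∑ y, NormedSpace.exp (generator r T) x y = 1 := by
  have h := hasSum_sum (s := Finset.univ) fun y _ => hasSum_exp_apply (generator r T) x y
  have hk : ∀ k, k ≠ 0 → ∑ y, (k ! : ℝ)⁻¹ * (generator r T ^ k) x y = 0 := by
    intro k hk
    obtain ⟨k, rfl⟩ := Nat.exists_eq_succ_of_ne_zero hk
    have : (generator r T ^ (k + 1)) *ᵥ 1 = 0 := by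
      rw [pow_succ, ← Matrix.mulVec_mulVec, generator_mulVec_one, Matrix.mulVec_zero]
    have := congrFun this x
    simp only [Matrix.mulVec, dotProduct, Pi.one_apply, mul_one, Pi.zero_apply] at this
    rw [← Finset.mul_sum, Nat.succ_eq_add_one, this, mul_zero]
  rw [h.unique (hasSum_single 0 hk)]
  simp [Matrix.one_apply]

/-- The composition of the maps `T e` along a word, the head of the word acting first. -/
def applyWord (T : E → S → S) (w : List E) (x : S) : S := w.foldl (fun z e => T e z) x

theorem jumpMatrix_pow_applyWord_pos {r : E → ℝ≥0} (hr : ∀ e, 0 < r e) (T : E → S → S)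
    (w : List E) (x : S) : 0 < (jumpMatrix r T ^ w.length) x (applyWord T w x) := by
  induction w generalizing x with
  | nil => simp [applyWord]
  | cons e w ih =>
    rw [List.length_cons, pow_succ', Matrix.mul_apply]
    refine lt_of_lt_of_le ?_ (Finset.single_le_sum (fun z _ => mul_nonneg (jumpMatrix_nonneg r T x z)
      (pow_nonneg_apply (jumpMatrix_nonneg r T) _ z _)) (Finset.mem_univ (T e x)))
    refine mul_pos ?_ (ih (T e x))
    simp only [jumpMatrix, Matrix.sum_apply, Matrix.smul_apply, smul_eq_mul]
    refine lt_of_lt_of_le ?_ (Finset.single_le_sum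
      (fun e' _ => mul_nonneg (r e').2 (mapMatrix_nonneg _ _ _)) (Finset.mem_univ e))
    simpa [mapMatrix] using hr e

/-- The exponential series contains every power of `jumpMatrix`, so the length of the one word `w`
suffices for all rows; finiteness of `S` then makes the bound uniform. -/
theorem exists_le_exp_generator {r : E → ℝ≥0} (hr : ∀ e, 0 < r e) {T : E → S → S} {w : List E}
    {x₀ : S} (hw : ∀ x, applyWord T w x = x₀) :
    ∃ ε > 0, ∀ x, ε ≤ NormedSpace.exp (generator r T) x x₀ := by
  have hpos : ∀ x, 0 < NormedSpace.exp (generator r T) x x₀ := by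
    intro x
    rw [exp_generator, Matrix.smul_apply, smul_eq_mul]
    refine mul_pos (Real.exp_pos _) (lt_of_lt_of_le ?_
      (pow_le_exp_apply (jumpMatrix_nonneg r T) w.length x x₀))
    rw [← hw x]
    exact mul_pos (by positivity) (jumpMatrix_pow_applyWord_pos hr T w x)
  obtain ⟨x, -, hx⟩ := Finset.exists_min_image Finset.univ
    (fun x => NormedSpace.exp (generator r T) x x₀) ⟨x₀, Finset.mem_univ _⟩
  exact ⟨_, hpos x, fun z => hx z (Finset.mem_univ z)⟩

/-- Doeblin's contraction: a stochastic matrix with a column bounded below by `ε` contracts the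
`ℓ¹` norm of vectors of sum zero. -/
theorem sum_abs_vecMul_le {K : Matrix S S ℝ} (hK : ∀ x y, 0 ≤ K x y) (hK1 : ∀ x, ∑ y, K x y = 1)
    {ε : ℝ} {x₀ : S} (hε : ∀ x, ε ≤ K x x₀) {v : S → ℝ} (hv : ∑ x, v x = 0) :
    ∑ y, |(v ᵥ* K) y| ≤ (1 - ε) * ∑ x, |v x| := by
  -- Subtracting ε from the column `x₀` does not change `v ᵥ* K`, because `v` has sum zero. It
  -- leaves a nonnegative matrix with row sums 1 - ε.
  have hL : ∀ x y, 0 ≤ K x y - if y = x₀ then ε else 0 := by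
    intro x y
    split_ifs with h
    · rw [h]; linarith [hε x]
    · linarith [hK x y]
  have h : ∀ y, (v ᵥ* K) y = ∑ x, v x * (K x y - if y = x₀ then ε else 0) := by
    intro y
    simp only [Matrix.vecMul, dotProduct, mul_sub, Finset.sum_sub_distrib, ← Finset.sum_mul, hv,
      zero_mul, sub_zero]
  calc ∑ y, |(v ᵥ* K) y| ≤ ∑ y, ∑ x, |v x| * (K x y - if y = x₀ then ε else 0) := by
        refine Finset.sum_le_sum fun y _ => ?_
        rw [h]
        refine (Finset.abs_sum_le_sum_abs _ _).trans (Finset.sum_le_sum fun x _ => ?_)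
        rw [abs_mul, abs_of_nonneg (hL x y)]
    _ = (1 - ε) * ∑ x, |v x| := by
        rw [Finset.sum_comm, Finset.mul_sum]
        refine Finset.sum_congr rfl fun x _ => ?_
        rw [← Finset.mul_sum, Finset.sum_sub_distrib, hK1]
        simp [mul_comm]

omit [DecidableEq S] in
theorem abs_vecMul_le {v : S → ℝ} (hv : ∀ y, |v y| ≤ 1) (G : Matrix S S ℝ) (y : S) :
    |(v ᵥ* G) y| ≤ ∑ x, ∑ y, |G x y| := by
  refine (Finset.abs_sum_le_sum_abs _ _).trans (Finset.sum_le_sum fun x _ => ?_)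
  rw [abs_mul]
  refine (mul_le_of_le_one_left (abs_nonneg _) (hv x)).trans ?_
  exact Finset.single_le_sum (fun z _ => abs_nonneg (G x z)) (Finset.mem_univ y)

/-- A bounded family of row vectors satisfying the forward equation with quadratic error is
propagated by the exponential of the generator. -/
theorem eq_vecMul_exp {G : Matrix S S ℝ} {v : ℝ≥0 → S → ℝ} {C : ℝ} (hv1 : ∀ s y, |v s y| ≤ 1)
    (hv : ∀ (y : S) (s h : ℝ≥0), |v (s + h) y - v s y - h * (v s ᵥ* G) y| ≤ C * h ^ 2)
    (t : ℝ≥0) : v (t + 1) = v t ᵥ* NormedSpace.exp G := by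
  set L := ∑ x, ∑ y, |G x y| with hL
  -- A state is needed to deduce `0 ≤ C`, since `S` may be empty here.
  have hC : S → 0 ≤ C := fun y => by
    simpa using (abs_nonneg _).trans (hv y 0 1)
  set f : ℝ → S → ℝ := fun u => v (t + u.toNNReal) with hf
  have hstep : ∀ (y : S) {a b : ℝ}, 0 ≤ a → a ≤ b →
      |f b y - f a y - (b - a) * (f a ᵥ* G) y| ≤ C * (b - a) ^ 2 := by
    intro y a b ha hab
    have h := hv y (t + a.toNNReal) (b - a).toNNReal
    rw [add_assoc, ← Real.toNNReal_add ha (sub_nonneg.2 hab), add_sub_cancel,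
      Real.coe_toNNReal _ (sub_nonneg.2 hab)] at h
    exact h
  have hlip : ∀ (y : S) {a b : ℝ}, 0 ≤ a → a ≤ b → b ≤ 1 → |f b y - f a y| ≤ (C + L) * (b - a) := by
    intro y a b ha hab hb
    have h1 := hstep y ha hab
    have h2 := abs_vecMul_le (hv1 (t + a.toNNReal)) G y
    have h3 : |(b - a) * (f a ᵥ* G) y| ≤ (b - a) * L := by
      rw [abs_mul, abs_of_nonneg (sub_nonneg.2 hab)]
      exact mul_le_mul_of_nonneg_left h2 (sub_nonneg.2 hab)
    have h4 : C * (b - a) ^ 2 ≤ C * (b - a) := by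
      refine mul_le_mul_of_nonneg_left ?_ (hC y)
      nlinarith
    have h5 := abs_add_le (f b y - f a y - (b - a) * (f a ᵥ* G) y) ((b - a) * (f a ᵥ* G) y)
    rw [sub_add_cancel] at h5
    linarith
  have hcont : ∀ y, ContinuousOn (fun u => f u y) (Set.Icc 0 1) := by
    intro y
    refine LipschitzOnWith.continuousOn (K := (C + L).toNNReal)
      (LipschitzOnWith.of_dist_le_mul fun a ha b hb => ?_)
    rw [Real.dist_eq, Real.dist_eq,
      Real.coe_toNNReal _ (add_nonneg (hC y) (by positivity))]
    rcases le_total a b with h | h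
    · rw [abs_sub_comm, abs_sub_comm a, abs_of_nonneg (sub_nonneg.2 h)]
      exact hlip y ha.1 h hb.2
    · rw [abs_of_nonneg (sub_nonneg.2 h)]
      exact hlip y hb.1 h ha.2
  -- The estimate only looks forward in time, so it yields right derivatives; together with
  -- continuity these suffice for constancy.
  have hderiv : ∀ y, ∀ a, 0 ≤ a →
      HasDerivWithinAt (fun u => f u y) ((f a ᵥ* G) y) (Set.Ici a) a := by
    intro y a ha
    rw [hasDerivWithinAt_iff_isLittleO]
    have ho : (fun u : ℝ => (u - a) ^ 2) =o[𝓝[≥] a] fun u => u - a := by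
      simpa only [Real.norm_eq_abs, sq_abs] using
        (Asymptotics.isLittleO_pow_sub_sub a one_lt_two).mono nhdsWithin_le_nhds
    refine Asymptotics.IsBigO.trans_isLittleO ?_ ho
    refine Asymptotics.IsBigO.of_bound C ?_
    filter_upwards [self_mem_nhdsWithin] with b hb
    rw [Real.norm_eq_abs, Real.norm_eq_abs, abs_of_nonneg (sq_nonneg (b - a)), smul_eq_mul]
    exact hstep y ha hb
  set e : ℝ → Matrix S S ℝ := fun u => NormedSpace.exp ((1 - u) • G) with he
  have hexp : ∀ x y a, HasDerivAt (fun u => e u x y) (-(G * e a) x y) a := by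
    intro x y a
    have h1 := (hasDerivAt_exp_smul_const' G (1 - a)).scomp a ((hasDerivAt_id a).const_sub 1)
    have h2 := (Matrix.entryLinearMap ℝ ℝ x y).toContinuousLinearMap.hasFDerivAt.comp_hasDerivAt
      a h1
    simpa using! h2
  ext y
  -- The row vector f(u) exp((1 - u)G) has zero right derivative; its values at u = 0 and u = 1 are
  -- the two sides of the claim.
  have hconst := constant_of_has_deriv_right_zero (a := 0) (b := 1)
    (f := fun u => ∑ x, f u x * e u x y)
    (continuousOn_finsetSum _ fun x _ => (hcont x).mul
      fun u _ => (hexp x y u).continuousAt.continuousWithinAt)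
    (fun a ha => by
      have h := HasDerivWithinAt.fun_sum (u := Finset.univ) fun x _ =>
        (hderiv x a ha.1).fun_mul (hexp x y a).hasDerivWithinAt
      convert h using 1
      simp only [Finset.sum_add_distrib, mul_neg, Finset.sum_neg_distrib]
      have h' := congrFun (Matrix.vecMul_vecMul (f a) G (e a)) y
      simp only [Matrix.vecMul, dotProduct] at h' ⊢
      rw [h', add_neg_cancel]) 1 (by simp)
  simpa [hf, he, Matrix.one_apply, Matrix.vecMul, dotProduct] using hconst

/-- Convergence to equilibrium: a family of probability vectors satisfying the forward equation
with quadratic error, for a chain with a synchronizing word, converges to an invariant vector. -/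
theorem exists_tendsto_of_forward_estimate {r : E → ℝ≥0} (hr : ∀ e, 0 < r e) {T : E → S → S}
    {w : List E} {x₀ : S} (hw : ∀ x, applyWord T w x = x₀) {v : ℝ≥0 → S → ℝ} {C : ℝ}
    (hv0 : ∀ s y, 0 ≤ v s y) (hv1 : ∀ s, ∑ y, v s y = 1)
    (hv : ∀ (y : S) (s h : ℝ≥0),
      |v (s + h) y - v s y - h * (v s ᵥ* generator r T) y| ≤ C * h ^ 2) :
    ∃ p : S → ℝ, Tendsto v atTop (𝓝 p) ∧ p ᵥ* generator r T = 0 := by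
  have hle : ∀ s y, |v s y| ≤ 1 := fun s y => by
    rw [abs_of_nonneg (hv0 s y), ← hv1 s]
    exact Finset.single_le_sum (fun z _ => hv0 s z) (Finset.mem_univ y)
  obtain ⟨ε, hε, hcol⟩ := exists_le_exp_generator hr hw
  have hstep := eq_vecMul_exp hle hv
  set d : ℝ≥0 → ℝ≥0 → ℝ := fun s t => ∑ y, |v s y - v t y| with hd
  have hε1 : ε ≤ 1 := by
    refine (hcol x₀).trans ?_
    rw [← exp_generator_sum r T x₀]
    exact Finset.single_le_sum (fun z _ => exp_generator_nonneg r T x₀ z) (Finset.mem_univ x₀)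
  have hcontr : ∀ s t, d (s + 1) (t + 1) ≤ (1 - ε) * d s t := by
    intro s t
    have h := sum_abs_vecMul_le (exp_generator_nonneg r T) (exp_generator_sum r T) hcol
      (v := v s - v t) (by simp [hv1])
    rw [Matrix.sub_vecMul, ← hstep, ← hstep] at h
    exact h
  have hiter : ∀ (k : ℕ) (s t : ℝ≥0), d (s + k) (t + k) ≤ (1 - ε) ^ k * 2 := by
    intro k
    induction k with
    | zero =>
      intro s t
      have h : d s t ≤ ∑ y, (v s y + v t y) := Finset.sum_le_sum fun y _ => by
        refine (abs_sub _ _).trans ?_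
        rw [abs_of_nonneg (hv0 s y), abs_of_nonneg (hv0 t y)]
      rw [Finset.sum_add_distrib, hv1, hv1] at h
      simp only [Nat.cast_zero, add_zero, pow_zero, one_mul]
      linarith
    | succ k ih =>
      intro s t
      rw [Nat.cast_succ, ← add_assoc, ← add_assoc, pow_succ']
      refine (hcontr _ _).trans ?_
      rw [mul_assoc]
      exact mul_le_mul_of_nonneg_left (ih s t) (sub_nonneg.2 hε1)
  have hdist : ∀ s t, dist (v s) (v t) ≤ d s t := fun s t => by
    refine (dist_pi_le_iff (Finset.sum_nonneg fun y _ => abs_nonneg _)).2 fun y => ?_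
    exact Finset.single_le_sum (f := fun y => |v s y - v t y|) (fun z _ => abs_nonneg _)
      (Finset.mem_univ y)
  have hcauchy : Cauchy (map v atTop) := by
    refine Metric.cauchy_iff.2 ⟨inferInstance, fun η hη => ?_⟩
    have hlim : Tendsto (fun k : ℕ => (1 - ε) ^ k * 2) atTop (𝓝 0) := by
      simpa using (tendsto_pow_atTop_nhds_zero_of_lt_one (sub_nonneg.2 hε1)
        (by linarith)).mul_const 2
    obtain ⟨k, hk⟩ := (hlim.eventually_lt_const hη).exists
    refine ⟨v '' Set.Ici (k : ℝ≥0), image_mem_map (Ici_mem_atTop _), ?_⟩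
    rintro _ ⟨s, hs, rfl⟩ _ ⟨t, ht, rfl⟩
    -- Any two times beyond k are k-fold unit shifts of nonnegative times, so no interpolation
    -- between integer times is needed.
    have h := hiter k (s - k) (t - k)
    rw [tsub_add_cancel_of_le hs, tsub_add_cancel_of_le ht] at h
    exact ((hdist s t).trans h).trans_lt hk
  obtain ⟨p, hp⟩ := CompleteSpace.complete hcauchy
  have hp : Tendsto v atTop (𝓝 p) := hp
  refine ⟨p, hp, funext fun y => ?_⟩
  have hy : ∀ x, Tendsto (fun s => v s x) atTop (𝓝 (p x)) := fun x => tendsto_pi_nhds.1 hp x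
  -- Letting s → ∞ in the forward estimate leaves a linear term bounded by a quadratic one.
  have hest : ∀ h : ℝ≥0, h * |(p ᵥ* generator r T) y| ≤ C * h ^ 2 := by
    intro h
    have hG : Tendsto (fun s => (v s ᵥ* generator r T) y) atTop (𝓝 ((p ᵥ* generator r T) y)) :=
      tendsto_finsetSum _ fun x _ => (hy x).mul_const _
    have hshift : Tendsto (fun s => v (s + h) y) atTop (𝓝 (p y)) :=
      (hy y).comp (tendsto_atTop_mono (fun s => le_self_add) tendsto_id)
    have := le_of_tendsto ((hshift.sub (hy y)).sub (hG.const_mul (h : ℝ))).abs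
      (Eventually.of_forall fun s => hv y s h)
    rwa [sub_self, zero_sub, abs_neg, abs_mul, abs_of_nonneg h.coe_nonneg] at this
  have hC : 0 ≤ C := by simpa using (abs_nonneg _).trans (hv y 0 1)
  set a := |(p ᵥ* generator r T) y| with ha
  have ha0 : 0 ≤ a := abs_nonneg _
  rw [Pi.zero_apply, ← abs_eq_zero]
  by_contra hne
  have hapos : 0 < a := lt_of_le_of_ne ha0 (Ne.symm hne)
  -- With h = a / (2(C + 1)), the bound h a ≤ C h² would give a ≤ C h < a.
  have h : a / (2 * (C + 1)) * a ≤ C * (a / (2 * (C + 1))) ^ 2 :=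
    hest ⟨a / (2 * (C + 1)), by positivity⟩
  have hb : 0 < a / (2 * (C + 1)) := by positivity
  have h2 : a ≤ C * (a / (2 * (C + 1))) := by
    refine le_of_mul_le_mul_left ?_ hb
    linarith
  have h3 : a = 2 * (C + 1) * (a / (2 * (C + 1))) := by field_simp
  nlinarith

end

/-! ### The queue as a finite chain and its balance equations -/

section

variable {Ω : Type*} [mΩ : MeasurableSpace Ω] {P : Measure Ω} {ℱ : Filtration ℝ≥0 mΩ}

open scoped Matrix

theorem vecMul_generator {E S : Type*} [Fintype E] [Fintype S] [DecidableEq S] (r : E → ℝ≥0)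
    (T : E → S → S) (v : S → ℝ) (y : S) :
    (v ᵥ* generator r T) y = ∑ e, r e * (∑ x with T e x = y, v x - v y) := by
  simp only [generator, jumpMatrix, Matrix.vecMul_sub, Matrix.vecMul_sum, Matrix.vecMul_smul,
    Pi.sub_apply, Finset.sum_apply, Pi.smul_apply, vecMul_mapMatrix, smul_eq_mul,
    Matrix.vecMul_one, Finset.sum_mul, ← Finset.sum_sub_distrib, mul_sub]

/-- A Poisson-driven process on a finite state space with a synchronizing word has limiting state
probabilities, which satisfy the balance equations. -/
theorem IsPoissonDriven.exists_tendsto {E S : Type*} [Fintype E] [Fintype S] [DecidableEq S]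
    [IsProbabilityMeasure P] {r : E → ℝ≥0} {N : E → ℝ≥0 → Ω → ℕ} {T : E → S → S} {Q : ℝ≥0 → Ω → S}
    (hQ : IsPoissonDriven P ℱ r N T Q) (hr : ∀ e, 0 < r e) {w : List E} {x₀ : S}
    (hw : ∀ x, applyWord T w x = x₀) :
    ∃ p : S → ℝ,
      (∀ y, Tendsto (fun t => P.real {ω | Q t ω ∈ ({y} : Set S)}) atTop (𝓝 (p y))) ∧
      ∀ y, ∑ e, r e * (∑ x with T e x = y, p x - p y) = 0 := by
  obtain ⟨C, hC⟩ := hQ.exists_forward_estimate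
  have hB : ∀ s B, MeasurableSet {ω | Q s ω ∈ B} := fun s B => ℱ.le s _ (hQ.adapted s B)
  have hsum : ∀ (s : ℝ≥0) (F : Finset S), P.real {ω | Q s ω ∈ (F : Set S)} =
      ∑ x ∈ F, P.real {ω | Q s ω ∈ ({x} : Set S)} := by
    intro s F
    rw [← measureReal_biUnion_finset _ fun x _ => hB s _]
    · congr 1
      ext ω
      simp
    · intro x _ y _ hxy
      refine Set.disjoint_left.2 fun ω hx hy => hxy ?_
      have hx : Q s ω = x := hx
      have hy : Q s ω = y := hy
      rw [← hx, hy]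
  obtain ⟨p, hp, hbal⟩ := exists_tendsto_of_forward_estimate hr hw (C := C)
    (v := fun s y => P.real {ω | Q s ω ∈ ({y} : Set S)}) (fun _ _ => measureReal_nonneg)
    (fun s => by rw [← hsum]; simp)
    (fun y s h => by
      refine le_of_eq_of_le ?_ (hC y s h)
      rw [vecMul_generator]
      have h : ∀ e, P.real {ω | Q s ω ∈ T e ⁻¹' {y}} =
          ∑ x with T e x = y, P.real {ω | Q s ω ∈ ({x} : Set S)} := fun e => by
        rw [← hsum]
        congr 2
        ext x
        simp
      simp only [h])
  exact ⟨p, tendsto_pi_nhds.1 hp, fun y => by rw [← vecMul_generator, hbal, Pi.zero_apply]⟩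

variable {n : ℕ}

/-- The state after a jump of the driving processes: an arrival (`none`), a retrial (`some none`)
or a service at the server `l` (`some (some l)`). -/
def step : Option (Option (Fin n)) → ℕ × ℕ → ℕ × ℕ
  | none, z => if z.1 = n then (n, 1) else (z.1 + 1, z.2)
  | some none, z => if z.1 ≠ n ∧ z.2 = 1 then (z.1 + 1, 0) else z
  | some (some l), z => if (l : ℕ) + 1 ≤ z.1 then (z.1 - 1, z.2) else z

theorem step_bounds (e : Option (Option (Fin n))) {z : ℕ × ℕ} (h1 : z.1 ≤ n) (h2 : z.2 ≤ 1) :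
    (step e z).1 ≤ n ∧ (step e z).2 ≤ 1 := by
  rcases e with _ | _ | l <;> simp only [step] <;> split_ifs <;> constructor <;> grind

/-- The state of the system as an element of a finite type. -/
def toState (n : ℕ) (z : ℕ × ℕ) : Fin (n + 1) × Fin 2 := (Fin.ofNat (n + 1) z.1, Fin.ofNat 2 z.2)

theorem toState_val (x : Fin (n + 1) × Fin 2) : toState n (x.1, x.2) = x := by
  simp [toState]

theorem val_toState_fst {z : ℕ × ℕ} (h : z.1 ≤ n) : ((toState n z).1 : ℕ) = z.1 := by
  simp only [toState, Fin.val_ofNat]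
  exact Nat.mod_eq_of_lt (by omega)

theorem val_toState_snd {z : ℕ × ℕ} (h : z.2 ≤ 1) : ((toState n z).2 : ℕ) = z.2 := by
  simp only [toState, Fin.val_ofNat]
  exact Nat.mod_eq_of_lt (by omega)

theorem toState_inj {z z' : ℕ × ℕ} (h1 : z.1 ≤ n) (h2 : z.2 ≤ 1) (h1' : z'.1 ≤ n)
    (h2' : z'.2 ≤ 1) : toState n z = toState n z' ↔ z = z' := by
  refine ⟨fun h => Prod.ext ?_ ?_, fun h => h ▸ rfl⟩
  · rw [← val_toState_fst h1, h, val_toState_fst h1']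
  · rw [← val_toState_snd (n := n) h2, h, val_toState_snd h2']

/-- The action of `step` on the finite state space. -/
def stepState (e : Option (Option (Fin n))) (x : Fin (n + 1) × Fin 2) : Fin (n + 1) × Fin 2 :=
  toState n (step e (x.1, x.2))

theorem stepState_toState (e : Option (Option (Fin n))) {z : ℕ × ℕ} (h1 : z.1 ≤ n)
    (h2 : z.2 ≤ 1) : stepState e (toState n z) = toState n (step e z) := by
  rw [stepState, val_toState_fst h1, val_toState_snd h2]

theorem applyWord_stepState (w : List (Option (Option (Fin n)))) {z : ℕ × ℕ} (h1 : z.1 ≤ n)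
    (h2 : z.2 ≤ 1) : applyWord stepState w (toState n z) = toState n (applyWord step w z) := by
  induction w generalizing z with
  | nil => rfl
  | cons e w ih =>
    have h := step_bounds e h1 h2
    have := ih h.1 h.2
    simp only [applyWord, List.foldl_cons] at this ⊢
    rw [stepState_toState e h1 h2, this]

/-- The server with index 0 works whenever anybody is in service; truncated subtraction accounts for
services that find the system empty. -/
theorem applyWord_step_replicate (hn : 1 ≤ n) (k : ℕ) (z : ℕ × ℕ) :
    applyWord step (List.replicate k (some (some (⟨0, hn⟩ : Fin n)))) z = (z.1 - k, z.2) := by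
  induction k generalizing z with
  | zero => rfl
  | succ k ih =>
    have := ih (step (some (some (⟨0, hn⟩ : Fin n))) z)
    simp only [applyWord, List.replicate_succ, List.foldl_cons] at this ⊢
    rw [this]
    simp only [step]
    split_ifs <;> ext <;> simp at * <;> omega

/-- Serving everybody, letting the orbit retry, and serving once more empties the system. -/
theorem applyWord_stepState_eq (hn : 1 ≤ n) (x : Fin (n + 1) × Fin 2) :
    applyWord stepState (List.replicate n (some (some (⟨0, hn⟩ : Fin n))) ++
      [some none, some (some ⟨0, hn⟩)]) x = toState n (0, 0) := by
  have h1 : (x.1 : ℕ) ≤ n := by omega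
  have h2 : (x.2 : ℕ) ≤ 1 := by omega
  have h := applyWord_step_replicate hn n ((x.1 : ℕ), (x.2 : ℕ))
  rw [← toState_val x, applyWord_stepState _ h1 h2]
  simp only [applyWord, List.foldl_append] at h ⊢
  rw [h]
  simp only [List.foldl_cons, List.foldl_nil, step, Nat.sub_eq_zero_of_le h1]
  congr 1
  split_ifs
  all_goals ext <;> simp at * <;> omega

/-- This moves preimages from the type of states to pairs of natural numbers, where they are found
by arithmetic. -/
theorem sum_filter_stepState (p : Fin (n + 1) × Fin 2 → ℝ) (e : Option (Option (Fin n)))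
    {y : ℕ × ℕ} (hy1 : y.1 ≤ n) (hy2 : y.2 ≤ 1) (F : Finset (ℕ × ℕ))
    (hF : ∀ z, z ∈ F ↔ z.1 ≤ n ∧ z.2 ≤ 1 ∧ step e z = y) :
    ∑ x with stepState e x = toState n y, p x = ∑ z ∈ F, p (toState n z) := by
  symm
  refine Finset.sum_nbij (toState n) (fun z hz => ?_) (fun z hz z' hz' h => ?_) (fun x hx => ?_)
    fun _ _ => rfl
  · obtain ⟨h1, h2, h3⟩ := (hF z).1 hz
    simp [stepState_toState e h1 h2, h3]
  · obtain ⟨h1, h2, -⟩ := (hF z).1 hz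
    obtain ⟨h1', h2', -⟩ := (hF z').1 hz'
    exact (toState_inj h1 h2 h1' h2').1 h
  · have h1 : (x.1 : ℕ) ≤ n := by omega
    have h2 : (x.2 : ℕ) ≤ 1 := by omega
    have hb := step_bounds e (z := ((x.1 : ℕ), (x.2 : ℕ))) h1 h2
    refine ⟨((x.1 : ℕ), (x.2 : ℕ)), (hF _).2 ⟨h1, h2, ?_⟩, toState_val x⟩
    have hx : stepState e x = toState n y := by simpa using hx
    exact (toState_inj hb.1 hb.2 hy1 hy2).1 hx

theorem sum_fin_ite_lt {k : ℕ} (hk : k ≤ n) (c : ℝ) :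
    ∑ l : Fin n, (if (l : ℕ) < k then c else 0) = k * c := by
  rw [Fin.sum_univ_eq_sum_range (fun l => if l < k then c else 0) n, ← Finset.sum_filter]
  have : Finset.filter (· < k) (Finset.range n) = Finset.range k := by
    ext l; simp; omega
  rw [this]
  simp

/-- The processes driving the system, indexed as in `step`. -/
def driver {α : Type*} (a d : α) (s : Fin n → α) : Option (Option (Fin n)) → α
  | none => a
  | some none => d
  | some (some l) => s l

section inflow

variable (q : Fin (n + 1) × Fin 2 → ℝ) {i j : ℕ}

/-- The server `l` works in a state with i busy servers exactly when l < i. Summed over `l`, the two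
indicators give the factors i + 1 and i. For l = i the state (i, j) is fixed and is also reached
from (i + 1, j). -/
theorem inflow_service (hi : i < n) (hj : j ≤ 1) (l : Fin n) :
    ∑ x with stepState (some (some l)) x = toState n (i, j), q x - q (toState n (i, j)) =
      (if (l : ℕ) < i + 1 then q (toState n (i + 1, j)) else 0) -
        if (l : ℕ) < i then q (toState n (i, j)) else 0 := by
  rcases lt_trichotomy (l : ℕ) i with hl | hl | hl
  · rw [sum_filter_stepState q _ hi.le hj {(i + 1, j)} (by grind [step]), if_pos (by omega),
      if_pos hl, Finset.sum_singleton]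
  · rw [sum_filter_stepState q _ hi.le hj {(i + 1, j), (i, j)} (by grind [step]),
      if_pos (by omega), if_neg (by omega), Finset.sum_pair (by simp)]
    ring
  · rw [sum_filter_stepState q _ hi.le hj {(i, j)} (by grind [step]), if_neg (by omega),
      if_neg (by omega), Finset.sum_singleton]
    ring

theorem inflow_service_full (hj : j ≤ 1) (l : Fin n) :
    ∑ x with stepState (some (some l)) x = toState n (n, j), q x = 0 := by
  rw [sum_filter_stepState q _ le_rfl hj ∅ (by grind [step]), Finset.sum_empty]

theorem inflow_arrival_zero (hn : 1 ≤ n) (hj : j ≤ 1) :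
    ∑ x with stepState none x = toState n (0, j), q x = 0 := by
  rw [sum_filter_stepState q _ (by simp) hj ∅ (by grind [step]), Finset.sum_empty]

theorem inflow_arrival (hi : 1 ≤ i) (hin : i < n ∨ i = n ∧ j = 0) (hj : j ≤ 1) :
    ∑ x with stepState none x = toState n (i, j), q x = q (toState n (i - 1, j)) := by
  rw [sum_filter_stepState q _ (by grind) hj {(i - 1, j)} (by grind [step]), Finset.sum_singleton]

/-- The preimage (n, 1) is a lost arrival; its term cancels in the balance equation. -/
theorem inflow_arrival_full (hn : 1 ≤ n) :
    ∑ x with stepState none x = toState n (n, 1), q x =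
      q (toState n (n - 1, 1)) + (q (toState n (n, 0)) + q (toState n (n, 1))) := by
  rw [sum_filter_stepState q _ le_rfl le_rfl {(n - 1, 1), (n, 0), (n, 1)} (by grind [step]),
    Finset.sum_insert (by grind), Finset.sum_pair (by simp)]

theorem inflow_retrial_zero :
    ∑ x with stepState (some none) x = toState n (0, 0), q x = q (toState n (0, 0)) := by
  rw [sum_filter_stepState q _ (by simp) (by simp) {(0, 0)} (by grind [step]),
    Finset.sum_singleton]

theorem inflow_retrial (hi : 1 ≤ i) (hin : i ≤ n) :
    ∑ x with stepState (some none) x = toState n (i, 0), q x =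
      q (toState n (i, 0)) + q (toState n (i - 1, 1)) := by
  rw [sum_filter_stepState q _ hin (by simp) {(i, 0), (i - 1, 1)} (by grind [step]),
    Finset.sum_pair (by simp)]

theorem inflow_retrial_orbit (hi : i < n) :
    ∑ x with stepState (some none) x = toState n (i, 1), q x = 0 := by
  rw [sum_filter_stepState q _ hi.le le_rfl ∅ (by grind [step]), Finset.sum_empty]

theorem inflow_retrial_full :
    ∑ x with stepState (some none) x = toState n (n, 1), q x = q (toState n (n, 1)) := by
  rw [sum_filter_stepState q _ le_rfl le_rfl {(n, 1)} (by grind [step]), Finset.sum_singleton]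

end inflow

/-- The balance equations of the system. -/
theorem balance_equations (hn : 1 ≤ n) {lam Δ μ : ℝ≥0} {q : Fin (n + 1) × Fin 2 → ℝ}
    (hq : ∀ y, ∑ e, ((driver (n := n) lam Δ (fun _ => μ) e : ℝ≥0) : ℝ) *
      (∑ x with stepState e x = y, q x - q y) = 0) {p : ℕ → ℕ → ℝ}
    (hp : ∀ i j, q (toState n (i, j)) = p i j) :
      (∀ j ≤ 1, μ * p 1 j = lam * p 0 j + j * Δ * p 0 j) ∧
      (∀ i, 1 ≤ i → i ≤ n - 1 → ∀ j ≤ 1,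
        i * μ * p i j - (i + 1) * μ * p (i + 1) j =
          lam * p (i - 1) j - lam * p i j + (1 - j) * Δ * p (i - 1) 1 - j * Δ * p i 1) ∧
      n * μ * p n 0 = lam * p (n - 1) 0 - lam * p n 0 + Δ * p (n - 1) 1 ∧
      n * μ * p n 1 = lam * p (n - 1) 1 + lam * p n 0 := by
  have hbal : ∀ i j, lam * (∑ x with stepState none x = toState n (i, j), q x - p i j) +
      (Δ * (∑ x with stepState (some none) x = toState n (i, j), q x - p i j) +
      μ * ∑ l, (∑ x with stepState (some (some l)) x = toState n (i, j), q x - p i j)) = 0 := by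
    intro i j
    have h := hq (toState n (i, j))
    rw [Fintype.sum_option, Fintype.sum_option] at h
    simp only [driver, ← Finset.mul_sum] at h
    simpa only [hp] using h
  have hserv : ∀ i < n, ∀ j ≤ 1,
      ∑ l, (∑ x with stepState (some (some l)) x = toState n (i, j), q x - p i j) =
        (i + 1) * p (i + 1) j - i * p i j := by
    intro i hi j hj
    have h := inflow_service q hi hj
    simp only [hp] at h
    simp only [h]
    rw [Finset.sum_sub_distrib, sum_fin_ite_lt (by omega), sum_fin_ite_lt hi.le]
    push_cast
    ring
  have hservn : ∀ j ≤ 1,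
      ∑ l, (∑ x with stepState (some (some l)) x = toState n (n, j), q x - p n j) =
        - (n * p n j) := by
    intro j hj
    simp [inflow_service_full q hj]
  refine ⟨fun j hj => ?_, fun i hi1 hi j hj => ?_, ?_, ?_⟩
  · have h := hbal 0 j
    rw [hserv 0 (by omega) j hj, inflow_arrival_zero q hn hj] at h
    interval_cases j
    · rw [inflow_retrial_zero, hp] at h
      simp at h ⊢
      linarith
    · rw [inflow_retrial_orbit q (by omega)] at h
      simp at h ⊢
      linarith
  · have h := hbal i j
    rw [hserv i (by omega) j hj, inflow_arrival q hi1 (by omega) hj, hp] at h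
    interval_cases j
    · rw [inflow_retrial q hi1 (by omega), hp, hp] at h
      push_cast
      linarith
    · rw [inflow_retrial_orbit q (by omega)] at h
      push_cast
      linarith
  · have h := hbal n 0
    rw [hservn 0 (by simp), inflow_arrival q hn (by omega) (by simp),
      inflow_retrial q hn le_rfl, hp, hp, hp] at h
    linarith
  · have h := hbal n 1
    rw [hservn 1 le_rfl, inflow_arrival_full q hn, inflow_retrial_full, hp, hp, hp] at h
    linarith

end

/-! ### The path equations determine the transitions -/

section

variable {n : ℕ}

/-- The equations of the system along one path, the driving paths being `N`. -/
structure IsSystemPath (n : ℕ) (N : Option (Option (Fin n)) → ℝ≥0 → ℕ) (q₁ q₂ q₃ : ℝ≥0 → ℕ) :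
    Prop where
  path : ∀ e, IsCountingPath (N e)
  total_eq : ∀ t, (q₁ t : ℤ) + q₂ t + q₃ t = N none t -
    ∑ l : Fin n, countingIntegral (N (some (some l)))
      (fun s => if (l : ℕ) + 1 ≤ before q₁ s then 1 else 0) t
  orbit_eq : ∀ t, (q₂ t : ℤ) + q₃ t =
    countingIntegral (N none) (fun s => if before q₁ s = n then 1 else 0) t -
    countingIntegral (N (some none))
      (fun s => if before q₁ s ≠ n ∧ before q₂ s = 1 then 1 else 0) t
  loss_eq : ∀ t, (q₃ t : ℤ) =
    countingIntegral (N none) (fun s => if before q₁ s = n ∧ before q₂ s = 1 then 1 else 0) t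

namespace IsSystemPath

variable {N : Option (Option (Fin n)) → ℝ≥0 → ℕ} {q₁ q₂ q₃ : ℝ≥0 → ℕ}

/-- A counting integral depends on t only through the count at t, so the three right-hand sides
agree at s and t; they determine `q₃`, then `q₂`, then `q₁`. -/
theorem stay (h : IsSystemPath n N q₁ q₂ q₃) {s t : ℝ≥0} (hN : ∀ e, N e t = N e s) :
    q₁ t = q₁ s ∧ q₂ t = q₂ s := by
  have ht := h.total_eq t
  have ho := h.orbit_eq t
  have hl := h.loss_eq t
  simp only [countingIntegral_congr_of_eq (hN _), hN none] at ht ho hl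
  have := h.total_eq s
  have := h.orbit_eq s
  have := h.loss_eq s
  omega

/-- By `stay` the state is constant from s up to the only driving point τ in (s, t]. The left limits
at τ are therefore the values at s, and the integrals driven by `N e` grow by integrands evaluated
at that state. The bound on `q₂ s` forces an empty orbit when a blocked arrival is not lost. -/
theorem jump (h : IsSystemPath n N q₁ q₂ q₃) {s t : ℝ≥0} (hs : q₂ s ≤ 1)
    {e : Option (Option (Fin n))} (he : N e t = N e s + 1) (hN : ∀ e', e' ≠ e → N e' t = N e' s) :
    (q₁ t, q₂ t) = step e (q₁ s, q₂ s) := by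
  set τ := pointTime (N e) (N e s + 1) with hτ
  have hsτ : s < τ := (h.path e).lt_pointTime (Nat.lt_succ_self _) he.ge
  have hτt : τ ≤ t := IsCountingPath.pointTime_le he.ge
  have hconst : ∀ u, s ≤ u → u < τ → q₁ u = q₁ s ∧ q₂ u = q₂ s := by
    intro u hsu huτ
    refine h.stay fun e' => ?_
    have h1 := (h.path e').mono hsu
    have h2 := (h.path e').mono (huτ.le.trans hτt)
    by_cases hee : e' = e
    · subst hee
      have : N e' u < N e' s + 1 := IsCountingPath.lt_of_lt_pointTime huτ
      omega
    · have := hN e' hee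
      omega
  have hb₁ : before q₁ τ = q₁ s := before_eq_of_forall_eq hsτ fun u h1 h2 => (hconst u h1 h2).1
  have hb₂ : before q₂ τ = q₂ s := before_eq_of_forall_eq hsτ fun u h1 h2 => (hconst u h1 h2).2
  have ht := h.total_eq t
  have ho := h.orbit_eq t
  have hl := h.loss_eq t
  have ht' := h.total_eq s
  have ho' := h.orbit_eq s
  have hl' := h.loss_eq s
  rcases e with _ | _ | l
  · have hD := hN (some none) (by simp)
    have hS : ∀ l, N (some (some l)) t = N (some (some l)) s := fun l => hN _ (by simp)
    simp only [countingIntegral_congr_of_eq hD, countingIntegral_congr_of_eq (hS _),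
      countingIntegral_of_eq_add_one he, ← hτ, hb₁, hb₂, he] at ht ho hl
    simp only [step]
    push_cast at ht
    split_ifs at * <;> ext <;> simp only <;> omega
  · have hA := hN none (by simp)
    have hS : ∀ l, N (some (some l)) t = N (some (some l)) s := fun l => hN _ (by simp)
    simp only [countingIntegral_congr_of_eq hA, countingIntegral_congr_of_eq (hS _),
      countingIntegral_of_eq_add_one he, ← hτ, hb₁, hb₂, hA] at ht ho hl
    simp only [step]
    split_ifs at * <;> ext <;> simp only <;> omega
  · have hA := hN none (by simp)
    have hD := hN (some none) (by simp)
    have hsum : ∑ m : Fin n, countingIntegral (N (some (some m)))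
          (fun s => if (m : ℕ) + 1 ≤ before q₁ s then 1 else 0) t =
        ∑ m : Fin n, countingIntegral (N (some (some m)))
          (fun s => if (m : ℕ) + 1 ≤ before q₁ s then 1 else 0) s +
          if (l : ℕ) + 1 ≤ q₁ s then 1 else 0 := by
      rw [← Finset.sum_erase_add _ _ (Finset.mem_univ l),
        ← Finset.sum_erase_add (a := l) Finset.univ _ (Finset.mem_univ l), add_assoc]
      congr 1
      · refine Finset.sum_congr rfl fun m hm => countingIntegral_congr_of_eq (hN _ ?_) _
        simpa using Finset.ne_of_mem_erase hm
      · rw [countingIntegral_of_eq_add_one he, ← hτ, hb₁]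
    rw [hsum] at ht
    simp only [countingIntegral_congr_of_eq hA, countingIntegral_congr_of_eq hD, hA] at ht ho hl
    simp only [step]
    split_ifs at * <;> ext <;> simp only <;> omega

end IsSystemPath

variable {Ω : Type*} [mΩ : MeasurableSpace Ω] {P : Measure Ω} {ℱ : Filtration ℝ≥0 mΩ}

theorem DisjointJumps.symm {X Y : ℝ≥0 → Ω → ℕ} (h : DisjointJumps P X Y) : DisjointJumps P Y X :=
  h.mono fun _ hω t => (hω t).symm

theorem IsRetrialLossSystem.isPoissonDriven {lam Δ μ : ℝ≥0} {A D : ℝ≥0 → Ω → ℕ}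
    {π : Fin n → ℝ≥0 → Ω → ℕ} {Q₁ Q₂ Q₃ : ℝ≥0 → Ω → ℕ}
    (hsys : IsRetrialLossSystem P ℱ n μ A D π Q₁ Q₂ Q₃) (hA : IsPoissonProcess P ℱ lam A)
    (hD : IsPoissonProcess P ℱ Δ D) :
    IsPoissonDriven P ℱ (driver lam Δ fun _ => μ) (driver A D π) stepState
      (fun t ω => toState n (Q₁ t ω, Q₂ t ω)) := by
  have hN : ∀ e, IsPoissonProcess P ℱ (driver (n := n) lam Δ (fun _ => μ) e) (driver A D π e) := by
    rintro (_ | _ | l)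
    exacts [hA, hD, hsys.services l]
  have hpath : ∀ᵐ ω ∂P, IsSystemPath n (fun e t => driver A D π e t ω)
      (fun t => Q₁ t ω) (fun t => Q₂ t ω) (fun t => Q₃ t ω) := by
    filter_upwards [ae_all_iff.2 fun e => (hN e).path, hsys.total_eq, hsys.orbit_eq, hsys.loss_eq]
      with ω h1 h2 h3 h4
    exact ⟨h1, h2, h3, h4⟩
  refine ⟨hN, ?_, fun t B => ?_, ?_, ?_⟩
  · rintro (_ | _ | l) (_ | _ | m) h
    · exact absurd rfl h
    · exact hsys.disjoint_arrivals_retrials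
    · exact hsys.disjoint_arrivals_services m
    · exact hsys.disjoint_arrivals_retrials.symm
    · exact absurd rfl h
    · exact hsys.disjoint_retrials_services m
    · exact (hsys.disjoint_arrivals_services l).symm
    · exact (hsys.disjoint_retrials_services l).symm
    · exact hsys.disjoint_services l m fun hlm => h (by rw [hlm])
  · exact ((hsys.adapted₁ t).prodMk (hsys.adapted₂ t))
      (MeasurableSet.of_discrete (s := toState n ⁻¹' B))
  · filter_upwards [hpath] with ω hω s t _ h
    have := hω.stay h
    rw [this.1, this.2]
  · filter_upwards [hpath, hsys.servers, hsys.orbit] with ω hω h1 h2 s t _ e he h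
    rw [stepState_toState e (h1 s) (h2 s)]
    exact congrArg (toState n) (hω.jump (h2 s) he h)

end

end RetrialQueue

theorem corollary1 {Ω : Type*} [mΩ : MeasurableSpace Ω] (P : Measure Ω) [IsProbabilityMeasure P]
    (ℱ : Filtration ℝ≥0 mΩ) (n : ℕ) (hn : 1 ≤ n) (lam Δ μ : ℝ≥0)
    (hlam : 0 < lam) (hΔ : 0 < Δ) (hμ : 0 < μ)
    (A D : ℝ≥0 → Ω → ℕ) (π : Fin n → ℝ≥0 → Ω → ℕ) (Q₁ Q₂ Q₃ : ℝ≥0 → Ω → ℕ)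
    (hsys : RetrialQueue.IsRetrialLossSystem P ℱ n μ A D π Q₁ Q₂ Q₃)
    (hA : RetrialQueue.IsPoissonProcess P ℱ lam A)
    (hD : RetrialQueue.IsPoissonProcess P ℱ Δ D) :
    ∃ p : ℕ → ℕ → ℝ,
      (∀ i ≤ n, ∀ j ≤ 1,
        Tendsto (fun t : ℝ≥0 => P.real {ω | Q₁ t ω = i ∧ Q₂ t ω = j}) atTop (𝓝 (p i j))) ∧
      (∀ j ≤ 1, μ * p 1 j = lam * p 0 j + j * Δ * p 0 j) ∧
      (∀ i, 1 ≤ i → i ≤ n - 1 → ∀ j ≤ 1,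
        i * μ * p i j - (i + 1) * μ * p (i + 1) j =
          lam * p (i - 1) j - lam * p i j + (1 - j) * Δ * p (i - 1) 1 - j * Δ * p i 1) ∧
      n * μ * p n 0 = lam * p (n - 1) 0 - lam * p n 0 + Δ * p (n - 1) 1 ∧
      n * μ * p n 1 = lam * p (n - 1) 1 + lam * p n 0 := by
  obtain ⟨q, hq, hbal⟩ := (hsys.isPoissonDriven hA hD).exists_tendsto
    (by rintro (_ | _ | l); exacts [hlam, hΔ, hμ]) (RetrialQueue.applyWord_stepState_eq hn)
  -- Outside the state space `toState` wraps around, but neither the limits nor the equations refer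
  -- to such indices.
  refine ⟨fun i j => q (RetrialQueue.toState n (i, j)), fun i hi j hj => ?_,
    RetrialQueue.balance_equations hn hbal fun _ _ => rfl⟩
  refine (hq (RetrialQueue.toState n (i, j))).congr fun t => ?_
  -- The two events agree only almost surely: `toState` is injective only within the bounds on `Q₁`
  -- and `Q₂`.
  refine measureReal_congr ?_
  filter_upwards [hsys.servers, hsys.orbit] with ω h1 h2
  have h : RetrialQueue.toState n (Q₁ t ω, Q₂ t ω) = RetrialQueue.toState n (i, j) ↔
      Q₁ t ω = i ∧ Q₂ t ω = j := by
    rw [RetrialQueue.toState_inj (h1 t) (h2 t) hi hj, Prod.mk.injEq]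
  exact propext h
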